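/- For $r \in (0,1)$ let $A_r = \{x \in \mathbb{R}^2 : r < |x| < 1\}$, and for $r \in (0,1)$, $\alpha \in (0,2\pi]$ let $$\Sigma_r^\alpha = \{(\varrho\cos\vartheta, \varrho\sin\vartheta) : \varrho \in (r,1),\ \vartheta \in (-\tfrac{\alpha}{2},\tfrac{\alpha}{2})\}.$$ For such a domain $\Omega$, a real number $\lambda$ is an eigenvalue of the Dirichlet problem $$-\Delta u = \lambda u \ \text{ in } \Omega, \qquad u = 0 \ \text{ on } \partial\Omega,$$ if this problem has a nonzero solution $u \in C^2(\Omega) \cap C(\overline{\Omega})$, and its multiplicity is the dimension of the real vector space of solutions. For an integer $\nu \ge 0$ and $k \ge 1$ let $a_{\nu,k}(r)$ be the $k$-th positive zero of the function $z \mapsto J_\nu(rz)Y_\nu(z) - J_\nu(z)Y_\nu(rz)$, where $J_\nu$ and $Y_\nu$ are the Bessel functions of the first and second kind, and put $\lambda_{\nu,k} = a_{\nu,k}(r)^2$. (1) There is $r \in (0,1)$ with $|r - 0.044951| < 10^{-6}$ such that $a_{3,1}(r) = a_{0,2}(r)$, and $\lambda = \lambda_{3,1} = \lambda_{0,2}$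 is an eigenvalue of the Dirichlet problem on $A_r$ whose multiplicity is at least $3$. (2) There are $r \in (0,1)$ and $\alpha \in (0,2\pi]$ such that the Dirichlet problem on $\Sigma_r^\alpha$ has an eigenvalue whose multiplicity is at least $2$. -/

import Mathlib

/-- The Euclidean plane. -/
abbrev Plane : Type := EuclideanSpace ℝ (Fin 2)

/-- The annulus (ring) with inner radius `r` and outer radius `1`. -/
def annulus (r : ℝ) : Set Plane := {x | r < ‖x‖ ∧ ‖x‖ < 1}

/-- The annular sector with inner radius `r`, outer radius `1` and opening angle `α`. -/
def annularSector (r α : ℝ) : Set Plane :=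
  {x | ∃ ρ θ : ℝ, r < ρ ∧ ρ < 1 ∧ -(α / 2) < θ ∧ θ < α / 2 ∧
    x = !₂[ρ * Real.cos θ, ρ * Real.sin θ]}

/-- The space of solutions `u` of `-Δ u = lam * u` in `Ω`, `u = 0` on `∂Ω`: real functions that are
continuous on the closure of `Ω` and twice continuously differentiable in `Ω`.  A function on the
closure that vanishes on the boundary is represented by its extension by zero to the plane, so
that two elements are equal exactly when they agree on `Ω`. -/
noncomputable def dirichletEigenspace (Ω : Set Plane) (lam : ℝ) : Submodule ℝ (Plane → ℝ) where
  carrier := {u | ContinuousOn u (closure Ω) ∧ (∀ x ∈ Ω, ContDiffAt ℝ 2 u x) ∧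
    (∀ x ∈ Ω, -(Laplacian.laplacian u x) = lam * u x) ∧ ∀ x, x ∉ Ω → u x = 0}
  zero_mem' := by
    refine ⟨continuousOn_const, fun x _ => contDiffAt_const, fun x _ => ?_, fun x _ => rfl⟩
    have h : Laplacian.laplacian (fun _ : Plane => (0 : ℝ)) = 0 := by simp
    have h' := congrFun h x
    change -(Laplacian.laplacian (fun _ : Plane => (0 : ℝ)) x) = lam * 0
    rw [h']
    simp
  add_mem' := by
    rintro u v ⟨hu1, hu2, hu3, hu4⟩ ⟨hv1, hv2, hv3, hv4⟩
    refine ⟨hu1.add hv1, fun x hx => (hu2 x hx).add (hv2 x hx), fun x hx => ?_, fun x hx => ?_⟩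
    · rw [(hu2 x hx).laplacian_add (hv2 x hx), neg_add, hu3 x hx, hv3 x hx, Pi.add_apply, mul_add]
    · simp [hu4 x hx, hv4 x hx]
  smul_mem' := by
    rintro c u ⟨hu1, hu2, hu3, hu4⟩
    refine ⟨hu1.const_smul c, fun x hx => (hu2 x hx).const_smul c, fun x hx => ?_, fun x hx => ?_⟩
    · rw [InnerProductSpace.laplacian_smul c (hu2 x hx), smul_eq_mul, Pi.smul_apply, smul_eq_mul,
        ← mul_neg, hu3 x hx]
      ring
    · simp [hu4 x hx]

/-- `lam` is an eigenvalue of the Dirichlet problem on `Ω`. -/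
def IsDirichletEigenvalue (Ω : Set Plane) (lam : ℝ) : Prop :=
  ∃ u ∈ dirichletEigenspace Ω lam, u ≠ 0

/-- The multiplicity of `lam`: the dimension of the space of solutions. -/
noncomputable def dirichletMultiplicity (Ω : Set Plane) (lam : ℝ) : Cardinal :=
  Module.rank ℝ (dirichletEigenspace Ω lam)

/-- The Bessel function of the first kind `J_n` of integer order `n ≥ 0`. -/
noncomputable def besselJ (n : ℕ) (x : ℝ) : ℝ :=
  ∑' k : ℕ, (-1) ^ k / ((Nat.factorial k : ℝ) * (Nat.factorial (n + k) : ℝ)) *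
    (x / 2) ^ (2 * k + n)

/-- The Bessel function of the second kind `Y_n` of integer order `n ≥ 0` at `x > 0`, by its
standard expansion; `harmonic k - γ` is the value at `k + 1` of the digamma function. -/
noncomputable def besselY (n : ℕ) (x : ℝ) : ℝ :=
  2 / Real.pi * besselJ n x * Real.log (x / 2)
    - 1 / Real.pi * ∑ k ∈ Finset.range n,
        (Nat.factorial (n - k - 1) : ℝ) / (Nat.factorial k : ℝ) * ((x / 2) ^ (2 * k) / (x / 2) ^ n)
    - 1 / Real.pi * ∑' k : ℕ,
        (((harmonic k : ℚ) : ℝ) + ((harmonic (n + k) : ℚ) : ℝ)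
            - 2 * Real.eulerMascheroniConstant) *
          ((-1) ^ k / ((Nat.factorial k : ℝ) * (Nat.factorial (n + k) : ℝ)) *
            (x / 2) ^ (2 * k + n))

/-- The cross-product of Bessel functions of order `n` for the inner radius `r`. -/
noncomputable def besselCross (n : ℕ) (r z : ℝ) : ℝ :=
  besselJ n (r * z) * besselY n z - besselJ n z * besselY n (r * z)

/-- `a` is the `k`-th positive zero of `f`: a positive zero such that `f` has exactly `k` zeros in
`(0, a]`. -/
def IsNthPosZero (f : ℝ → ℝ) (k : ℕ) (a : ℝ) : Prop :=
  0 < a ∧ f a = 0 ∧ {z : ℝ | 0 < z ∧ z ≤ a ∧ f z = 0}.encard = (k : ℕ∞)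

open Filter Topology

/-! In the variable v = x²/4 one has J_n(x) = (x/2)^n φ_n(v) with φ_n entire and φ_n' = -φ_{n+1},
and Y_n is, up to the factor (2/π)(x/2)^n, a second solution ψ_n plus a multiple of φ_n. Up to a
positive factor the cross-product at z is therefore `crossSol n (r²w) w` with w = z²/4. When it
vanishes, f = `crossSol n (r²w)` vanishes at r²w and at w, and f(w|x|²) Re(c ζ^n) is a Dirichlet
eigenfunction on the annulus for λ = 4w. A common w for the orders 0 and 3 gives three independent
ones: c = 1 for order 0, and c = 1, i for order 3 (`annulus_eigen`).

The common w is found by controlling both families of zeros up to w = 10.2. For order 3, 2r⁶w³ times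
`crossSol` is the function `crossThree`: a perturbation of size r⁶ of φ_3(w) times a factor close to
2. It is strictly decreasing in w (`crossThree_strictAntiOn`), so it has exactly one zero W(r),
which is the first zero and is continuous in r. For order 0, dividing by φ_0(r²w) φ_0(w) leaves
`crossQuot`, which by the Wronskian and |φ_0(w)| < φ_0(r²w) increases between zeros of φ_0. Hence
there is no zero before the first zero of J_0, exactly one between the first two, and at most one
from there to 10.2, so a zero with w ≥ 10.17 is the second (`isNthPosZero_besselCross_zero`).
Numerical enclosures show that `crossQuot r (W r)` changes sign between r = 0.04495 and r =
0.044952, and the intermediate value theorem gives `exists_common_zero`.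

For the sector, α = 2π gives the annulus slit along a ray. There ρ^κ cos(κθ) vanishes on the slit
for κ = 1/2 and κ = 7/2, and the radial factors are elementary. If the outer and inner arguments y
and x differ by 2π, order 1/2 is satisfied automatically, and order 7/2 reduces to a polynomial
equation in x that has a root in [1/2, 1] (`exists_radialSol_pair`). -/

theorem hasSum_congr_of_eq {f g : ℕ → ℝ} {a : ℝ} (hf : HasSum f a) (h : ∀ k, f k = g k) :
    HasSum g a :=
  funext h ▸ hf

/-! ### Power series with Bessel-type coefficients -/

/-- The sum of the power series with coefficients `c`. -/
noncomputable def powerSum (c : ℕ → ℝ) (w : ℝ) : ℝ := ∑' k, c k * w ^ k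

/-- Coefficients of the formal derivative. -/
def derivCoeff (c : ℕ → ℝ) (k : ℕ) : ℝ := (k + 1) * c (k + 1)

/-- Decay of coefficients at the rate of a Bessel series. -/
def BesselDecay (A : ℝ) (c : ℕ → ℝ) : Prop :=
  ∀ k, |c k| ≤ A * 2 ^ k / (k.factorial : ℝ) ^ 2

theorem BesselDecay.formalDeriv {A : ℝ} {c : ℕ → ℝ} (h : BesselDecay A c) :
    BesselDecay (2 * A) (derivCoeff c) := by
  intro k
  have hk := h (k + 1)
  have hA : 0 ≤ A := by simpa using (abs_nonneg _).trans (h 0)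
  have hf : (0 : ℝ) < k.factorial := by positivity
  have hk1 : (0 : ℝ) < (k : ℝ) + 1 := by positivity
  rw [derivCoeff, abs_mul, abs_of_pos hk1]
  calc ((k : ℝ) + 1) * |c (k + 1)|
      ≤ ((k : ℝ) + 1) * (A * 2 ^ (k + 1) / ((k + 1).factorial : ℝ) ^ 2) := by gcongr
    _ = 2 * A * 2 ^ k / (k.factorial : ℝ) ^ 2 / ((k : ℝ) + 1) := by
        rw [Nat.factorial_succ]; push_cast; field_simp; ring
    _ ≤ _ := div_le_self (by positivity) (by linarith [Nat.cast_nonneg (α := ℝ) k])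

/-- Giving up one of the two factorials leaves the exponential series as a majorant. -/
theorem BesselDecay.shift {A : ℝ} {c : ℕ → ℝ} (h : BesselDecay A c) (w : ℝ) (k : ℕ) :
    |c k * w ^ k| ≤ A * ((2 * |w|) ^ k / k.factorial) := by
  have hA : 0 ≤ A := by simpa using (abs_nonneg _).trans (h 0)
  have hf : (1 : ℝ) ≤ k.factorial := by exact_mod_cast Nat.one_le_iff_ne_zero.2 k.factorial_ne_zero
  rw [abs_mul, abs_pow]
  calc |c k| * |w| ^ k ≤ (A * 2 ^ k / (k.factorial : ℝ) ^ 2) * |w| ^ k := by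
        gcongr; exact h k
    _ = A * ((2 * |w|) ^ k / k.factorial) / k.factorial := by
        rw [mul_pow]; field_simp
    _ ≤ _ := div_le_self (by positivity) hf

theorem BesselDecay.summable {A : ℝ} {c : ℕ → ℝ} (h : BesselDecay A c) (w : ℝ) :
    Summable fun k => c k * w ^ k :=
  Summable.of_norm_bounded ((Real.summable_pow_div_factorial (2 * |w|)).mul_left A)
    fun k => h.shift w k

/-- The remainder of the series after `K` terms. -/
theorem BesselDecay.abs_powerSum_sub_le {A : ℝ} {c : ℕ → ℝ} (h : BesselDecay A c) {w : ℝ} (K : ℕ)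
    (hw : |w| ≤ ((K : ℝ) + 1) ^ 2 / 4) :
    |powerSum c w - ∑ k ∈ Finset.range K, c k * w ^ k| ≤
      2 * (A * (2 * |w|) ^ K / (K.factorial : ℝ) ^ 2) := by
  have hA : 0 ≤ A := by simpa using (abs_nonneg _).trans (h 0)
  have hb : ∀ k, |c (k + K) * w ^ (k + K)| ≤
      (A * (2 * |w|) ^ K / (K.factorial : ℝ) ^ 2) * (1 / 2) ^ k := by
    intro k
    have h1 : |c (k + K) * w ^ (k + K)| ≤
        A * (2 * |w|) ^ (k + K) / ((k + K).factorial : ℝ) ^ 2 := by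
      rw [abs_mul, abs_pow]
      calc |c (k + K)| * |w| ^ (k + K)
          ≤ (A * 2 ^ (k + K) / ((k + K).factorial : ℝ) ^ 2) * |w| ^ (k + K) := by
            gcongr; exact h _
        _ = _ := by rw [mul_pow]; ring
    refine h1.trans ?_
    clear h1
    induction k with
    | zero => simp
    | succ k ih =>
      have e : A * (2 * |w|) ^ (k + 1 + K) / ((k + 1 + K).factorial : ℝ) ^ 2 =
          A * (2 * |w|) ^ (k + K) / ((k + K).factorial : ℝ) ^ 2 *
            (2 * |w| / ((k : ℝ) + K + 1) ^ 2) := by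
        rw [show k + 1 + K = (k + K) + 1 by ring, Nat.factorial_succ]; push_cast; field_simp; ring
      rw [e, pow_succ (1 / 2 : ℝ), ← mul_assoc]
      -- The hypothesis on `K` makes the ratio of consecutive bounds at most 1/2, so the tail is at
      -- most twice its first bound.
      have hr : 2 * |w| / ((k : ℝ) + K + 1) ^ 2 ≤ 1 / 2 := by
        rw [div_le_iff₀ (by positivity)]
        have : ((K : ℝ) + 1) ^ 2 ≤ ((k : ℝ) + K + 1) ^ 2 := by
          gcongr; linarith [Nat.cast_nonneg (α := ℝ) k]
        linarith
      exact mul_le_mul ih hr (by positivity) (by positivity)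
  have hs := (h.summable w).sum_add_tsum_nat_add K
  rw [powerSum, ← hs, add_sub_cancel_left]
  have hg := (hasSum_geometric_two).mul_left (A * (2 * |w|) ^ K / (K.factorial : ℝ) ^ 2)
  have := tsum_of_norm_bounded (f := fun k => c (k + K) * w ^ (k + K)) hg hb
  rw [mul_comm 2]
  simpa using this

theorem BesselDecay.hasDerivAt {A : ℝ} {c : ℕ → ℝ} (h : BesselDecay A c) (w : ℝ) :
    HasDerivAt (powerSum c) (powerSum (derivCoeff c) w) w := by
  have hA : 0 ≤ A := by simpa using (abs_nonneg _).trans (h 0)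
  set R : ℝ := |w| + 1 with hR
  have hR0 : 0 < R := by positivity
  -- Termwise differentiation needs a majorant uniform on a ball around `w`. Since `k - 1` is
  -- truncated, the index 0 is treated apart; its term vanishes.
  have key : ∀ k : ℕ, ∀ y ∈ Metric.ball (0 : ℝ) R, ‖c k * (k * y ^ (k - 1))‖ ≤
      (fun k : ℕ => if k = 0 then 0 else 2 * A * ((2 * R) ^ (k - 1) / (k - 1).factorial)) k := by
    intro k y hy
    rcases k with _ | k
    · simp
    · have h1 := h.formalDeriv.shift y k
      have hy' : |y| ≤ R := by simpa using (mem_ball_zero_iff.1 hy).le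
      simp only [Nat.add_sub_cancel, Nat.succ_ne_zero, if_false, Real.norm_eq_abs]
      rw [derivCoeff] at h1
      calc |c (k + 1) * (((k + 1 : ℕ) : ℝ) * y ^ k)| = |((k : ℝ) + 1) * c (k + 1) * y ^ k| := by
            push_cast; congr 1; ring
        _ ≤ _ := h1
        _ ≤ _ := by gcongr
  have hsum : Summable (fun k : ℕ => if k = 0 then 0 else
      2 * A * ((2 * R) ^ (k - 1) / (k - 1).factorial)) := by
    rw [← summable_nat_add_iff 1]
    simpa using (Real.summable_pow_div_factorial (2 * R)).mul_left (2 * A)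
  have hd := hasDerivAt_tsum_of_isPreconnected hsum Metric.isOpen_ball
    (convex_ball (0 : ℝ) R).isPreconnected
    (g := fun k y => c k * y ^ k) (g' := fun k y => c k * (k * y ^ (k - 1)))
    (fun k y _ => (hasDerivAt_pow k y).const_mul (c k)) key
    (Metric.mem_ball_self hR0) (h.summable 0) (y := w)
    (by rw [mem_ball_zero_iff, Real.norm_eq_abs]; linarith)
  have hs : Summable fun k : ℕ => c k * (k * w ^ (k - 1)) :=
    Summable.of_norm_bounded hsum fun k => key k w
      (by rw [mem_ball_zero_iff, Real.norm_eq_abs]; linarith)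
  rw [hs.tsum_eq_zero_add] at hd
  simp only [CharP.cast_eq_zero, zero_mul, mul_zero, zero_add, Nat.add_sub_cancel] at hd
  have e : powerSum (derivCoeff c) w = ∑' k : ℕ, c (k + 1) * (((k + 1 : ℕ) : ℝ) * w ^ k) :=
    tsum_congr fun k => by rw [derivCoeff]; push_cast; ring
  rw [e]
  exact hd

theorem BesselDecay.continuous {A : ℝ} {c : ℕ → ℝ} (h : BesselDecay A c) :
    Continuous (powerSum c) :=
  continuous_iff_continuousAt.2 fun w => (h.hasDerivAt w).continuousAt

/-- The second-order operator `w F'' + (n + 1) F' + F` acts on coefficients. -/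
theorem BesselDecay.hasSum_operator {A : ℝ} {c : ℕ → ℝ} (h : BesselDecay A c) (n : ℕ) (w : ℝ) :
    HasSum (fun k : ℕ => (((k : ℝ) + 1) * (k + n + 1) * c (k + 1) + c k) * w ^ k)
      (w * powerSum (derivCoeff (derivCoeff c)) w
        + (n + 1) * powerSum (derivCoeff c) w + powerSum c w) := by
  have h0 : HasSum _ (powerSum c w) := (h.summable w).hasSum
  have h1 : HasSum _ (powerSum (derivCoeff c) w) := (h.formalDeriv.summable w).hasSum
  have h2 : HasSum _ (w * powerSum (derivCoeff (derivCoeff c)) w) :=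
    (h.formalDeriv.formalDeriv.summable w).hasSum.mul_left w
  have h2' : HasSum (fun k : ℕ => (k : ℝ) * derivCoeff c k * w ^ k)
      (w * powerSum (derivCoeff (derivCoeff c)) w) := by
    rw [← hasSum_nat_add_iff' 1]
    simp only [Finset.range_one, Finset.sum_singleton, CharP.cast_eq_zero, zero_mul, sub_zero]
    refine hasSum_congr_of_eq h2 fun k => ?_
    simp only [derivCoeff]; push_cast; ring
  refine hasSum_congr_of_eq ((h2'.add (h1.mul_left ((n : ℝ) + 1))).add h0) fun k => ?_
  simp only [derivCoeff]; ring

/-- Reduces a bound uniform in `w` to one evaluation, at `W`, of the series of absolute values. -/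
theorem BesselDecay.abs_powerSum_le {A : ℝ} {c : ℕ → ℝ} (h : BesselDecay A c) {w W : ℝ}
    (hw : |w| ≤ W) : |powerSum c w| ≤ powerSum (fun k => |c k|) W := by
  have h' : BesselDecay A (fun k => |c k|) := fun k => by simpa using h k
  refine (norm_tsum_le_tsum_norm (h.summable w).norm).trans ?_
  refine Summable.tsum_le_tsum (fun k => ?_) (h.summable w).norm (h'.summable W)
  rw [norm_mul, norm_pow, Real.norm_eq_abs, Real.norm_eq_abs]
  gcongr

/-! ### The entire functions φ_n and σ_n, and the second solution -/

/-- Coefficients of the entire function `φ_n` with `J_n(x) = (x/2)^n φ_n(x²/4)`. -/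
noncomputable def phiCoeff (n k : ℕ) : ℝ := (-1) ^ k / ((k.factorial : ℝ) * (n + k).factorial)

/-- Coefficients of the entire part of the second solution. -/
noncomputable def sigmaCoeff (n k : ℕ) : ℝ :=
  -((((harmonic k : ℚ) : ℝ) + ((harmonic (n + k) : ℚ) : ℝ)) / 2) * phiCoeff n k

/-- The entire function `φ_n` with `J_n(x) = (x/2)^n φ_n(x²/4)`. -/
noncomputable def phi (n : ℕ) : ℝ → ℝ := powerSum (phiCoeff n)

/-- The entire part of the second solution. -/
noncomputable def sigma (n : ℕ) : ℝ → ℝ := powerSum (sigmaCoeff n)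

/-- The polar part of the second solution. -/
noncomputable def polarPart (n : ℕ) (v : ℝ) : ℝ :=
  ∑ k ∈ Finset.range n, ((n - k - 1).factorial : ℝ) / (k.factorial : ℝ) * (v ^ k / v ^ n)

/-- The second solution in the variable `v = x²/4`. -/
noncomputable def psi (n : ℕ) (v : ℝ) : ℝ :=
  Real.log v / 2 * phi n v + sigma n v - polarPart n v / 2

/-- The solution that vanishes at `m`. -/
noncomputable def crossSol (n : ℕ) (m v : ℝ) : ℝ := phi n m * psi n v - phi n v * psi n m

theorem abs_phiCoeff (n k : ℕ) :
    |phiCoeff n k| = 1 / ((k.factorial : ℝ) * (n + k).factorial) := by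
  rw [phiCoeff, abs_div, abs_pow, abs_neg, abs_one, one_pow, abs_of_pos (by positivity)]

theorem phiCoeff_succ (n k : ℕ) :
    ((k : ℝ) + 1) * (n + k + 1) * phiCoeff n (k + 1) = -phiCoeff n k := by
  rw [phiCoeff, phiCoeff, ← add_assoc, Nat.factorial_succ, Nat.factorial_succ]
  push_cast
  field_simp
  ring

theorem abs_phiCoeff_le (n k : ℕ) : |phiCoeff n k| ≤ 1 / (k.factorial : ℝ) ^ 2 := by
  rw [abs_phiCoeff, sq]
  gcongr
  omega

theorem phiCoeff_decay (n : ℕ) : BesselDecay 1 (phiCoeff n) := fun k => by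
  refine (abs_phiCoeff_le n k).trans ?_
  rw [one_mul]
  gcongr
  exact one_le_pow₀ (by norm_num)

theorem harmonic_nonneg_real (k : ℕ) : (0 : ℝ) ≤ ((harmonic k : ℚ) : ℝ) := by
  have : 0 ≤ harmonic k := Finset.sum_nonneg fun i _ => by positivity
  exact_mod_cast this

theorem harmonic_le_self (k : ℕ) : ((harmonic k : ℚ) : ℝ) ≤ k := by
  have : harmonic k ≤ k := by
    refine (Finset.sum_le_card_nsmul _ _ 1 fun i _ => ?_).trans (by simp)
    exact inv_le_one_of_one_le₀ (by push_cast; linarith [Nat.cast_nonneg (α := ℚ) i])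
  exact_mod_cast this

/-- Harmonic numbers grow at most linearly; the factor `2 ^ k` in `BesselDecay` is there to absorb
them. -/
theorem sigmaCoeff_decay (n : ℕ) : BesselDecay (n + 1) (sigmaCoeff n) := fun k => by
  rw [sigmaCoeff, abs_mul, abs_neg,
    abs_of_nonneg (by linarith [harmonic_nonneg_real k, harmonic_nonneg_real (n + k)])]
  have h1 := harmonic_le_self k
  have h2 := harmonic_le_self (n + k)
  push_cast at h2
  have h3 : (k : ℝ) ≤ 2 ^ k := by exact_mod_cast (Nat.lt_two_pow_self (n := k)).le
  have h4 : (1 : ℝ) ≤ 2 ^ k := one_le_pow₀ (by norm_num)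
  have h5 : (n : ℝ) * 1 ≤ n * 2 ^ k := by gcongr
  calc (((harmonic k : ℚ) : ℝ) + ((harmonic (n + k) : ℚ) : ℝ)) / 2 * |phiCoeff n k|
      ≤ ((n + 1) * 2 ^ k) * (1 / (k.factorial : ℝ) ^ 2) := by
        refine mul_le_mul ?_ (abs_phiCoeff_le n k) (abs_nonneg _) (by positivity)
        linarith
    _ = _ := by ring

theorem derivCoeff_phiCoeff (n : ℕ) : derivCoeff (phiCoeff n) = fun k => -phiCoeff (n + 1) k := by
  funext k
  rw [derivCoeff, phiCoeff, phiCoeff, show n + (k + 1) = n + 1 + k by ring, Nat.factorial_succ]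
  push_cast
  field_simp
  ring

theorem powerSum_neg (c : ℕ → ℝ) (w : ℝ) : powerSum (fun k => -c k) w = -powerSum c w := by
  simp only [powerSum, neg_mul, tsum_neg]

/-- The rule (x^{-n} J_n)' = -x^{-n} J_{n+1} in the variable v. It lets signs of φ_{n+1} decide the
monotonicity of φ_n, and signs of φ_{n+2} its convexity. -/
theorem hasDerivAt_phi (n : ℕ) (w : ℝ) : HasDerivAt (phi n) (-phi (n + 1) w) w := by
  have := (phiCoeff_decay n).hasDerivAt w
  rwa [derivCoeff_phiCoeff, powerSum_neg] at this

/-- The derivative of `sigma`. -/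
noncomputable def sigmaDeriv (n : ℕ) : ℝ → ℝ := powerSum (derivCoeff (sigmaCoeff n))

/-- The second derivative of `sigma`. -/
noncomputable def sigmaDeriv2 (n : ℕ) : ℝ → ℝ := powerSum (derivCoeff (derivCoeff (sigmaCoeff n)))

theorem hasDerivAt_sigma (n : ℕ) (w : ℝ) : HasDerivAt (sigma n) (sigmaDeriv n w) w :=
  (sigmaCoeff_decay n).hasDerivAt w

theorem hasDerivAt_sigmaDeriv (n : ℕ) (w : ℝ) :
    HasDerivAt (sigmaDeriv n) (sigmaDeriv2 n w) w :=
  (sigmaCoeff_decay n).formalDeriv.hasDerivAt w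

theorem phi_continuous (n : ℕ) : Continuous (phi n) := (phiCoeff_decay n).continuous

theorem sigma_continuous (n : ℕ) : Continuous (sigma n) := (sigmaCoeff_decay n).continuous

theorem phi_ode (n : ℕ) (w : ℝ) :
    w * phi (n + 2) w - (n + 1) * phi (n + 1) w + phi n w = 0 := by
  have h := (phiCoeff_decay n).hasSum_operator n w
  have h0 : ∀ k : ℕ, (((k : ℝ) + 1) * (k + n + 1) * phiCoeff n (k + 1) + phiCoeff n k) * w ^ k
      = 0 := fun k => by
    rw [show ((k : ℝ) + n + 1) = n + k + 1 by ring, phiCoeff_succ]; ring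
  simp only [h0] at h
  have h1 := h.unique hasSum_zero
  have e1 : powerSum (derivCoeff (phiCoeff n)) w = -phi (n + 1) w := by
    rw [derivCoeff_phiCoeff, powerSum_neg]; rfl
  have e2 : powerSum (derivCoeff (derivCoeff (phiCoeff n))) w = phi (n + 2) w := by
    have := (hasDerivAt_phi (n + 1) w).neg
    have h2 := (phiCoeff_decay n).formalDeriv.hasDerivAt w
    rw [show powerSum (derivCoeff (phiCoeff n)) = -phi (n + 1) from funext fun v => by
      rw [derivCoeff_phiCoeff, powerSum_neg]; rfl] at h2
    rw [h2.unique this, neg_neg]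
  rw [e1, e2] at h1
  unfold phi at *
  linarith

/-- Passing from k to k + 1 adds 1/(k+1) and 1/(n+k+1) to the two harmonic numbers, which produces
the φ-terms. The factor `w` avoids a quotient singular at 0; the missing constant term 1/n! is what
the polar part has to supply. -/
theorem sigma_ode (n : ℕ) (w : ℝ) :
    w * (w * sigmaDeriv2 n w + (n + 1) * sigmaDeriv n w + sigma n w - phi (n + 1) w) =
      -(n / 2 * (phi n w - 1 / n.factorial)) := by
  have h := ((sigmaCoeff_decay n).hasSum_operator n w).sub
    (((phiCoeff_decay (n + 1)).summable w).hasSum)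
  have h1 := h.mul_left w
  have h2 : HasSum (fun k => phiCoeff n (k + 1) * w ^ (k + 1)) (phi n w - 1 / n.factorial) := by
    have : HasSum _ (phi n w) := ((phiCoeff_decay n).summable w).hasSum
    rw [← hasSum_nat_add_iff' 1] at this
    simpa [phiCoeff] using this
  have h3 := (h2.mul_left ((n : ℝ) / 2)).neg
  refine h1.unique (hasSum_congr_of_eq h3 fun k => ?_)
  have e0 := phiCoeff_succ n k
  have e1 : ((n : ℝ) + k + 1) * phiCoeff (n + 1) k = phiCoeff n k := by
    rw [phiCoeff, phiCoeff, show n + 1 + k = n + k + 1 by ring, Nat.factorial_succ]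
    push_cast
    field_simp
  have e2 : (((harmonic (k + 1) : ℚ)) : ℝ) = ((harmonic k : ℚ) : ℝ) + 1 / ((k : ℝ) + 1) := by
    rw [harmonic_succ]; push_cast; rw [one_div]
  have e3 : (((harmonic (n + (k + 1)) : ℚ)) : ℝ) =
      ((harmonic (n + k) : ℚ) : ℝ) + 1 / ((n : ℝ) + k + 1) := by
    rw [← add_assoc, harmonic_succ]; push_cast; rw [one_div]
  have e4 : phiCoeff (n + 1) k = -((k : ℝ) + 1) * phiCoeff n (k + 1) := by
    have : ((n : ℝ) + k + 1) ≠ 0 := by positivity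
    apply mul_left_cancel₀ this
    rw [e1]; linarith
  have e5 : phiCoeff n k = -(((k : ℝ) + 1) * (n + k + 1) * phiCoeff n (k + 1)) := by
    rw [e0, neg_neg]
  rw [sigmaCoeff, sigmaCoeff, e2, e3, e4, e5]
  field_simp
  ring

/-! ### Solutions of the Bessel equation in the variable v -/

/-- `f` solves `v f'' + (n + 1) f' + f = 0` on the positive half-line. -/
def IsBesselSol (n : ℕ) (f : ℝ → ℝ) : Prop :=
  ∃ f' f'' : ℝ → ℝ, ∀ v, 0 < v → HasDerivAt f (f' v) v ∧ HasDerivAt f' (f'' v) v ∧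
    ContinuousAt f'' v ∧ v * f'' v + (n + 1) * f' v + f v = 0

/-- The combination is written exactly as in `crossSol`, so that it applies there by unfolding. -/
theorem IsBesselSol.linearComb {n : ℕ} {f g : ℝ → ℝ} (hf : IsBesselSol n f)
    (hg : IsBesselSol n g) (a b : ℝ) : IsBesselSol n (fun v => a * f v - g v * b) := by
  obtain ⟨f', f'', hf⟩ := hf
  obtain ⟨g', g'', hg⟩ := hg
  refine ⟨fun v => a * f' v - g' v * b, fun v => a * f'' v - g'' v * b, fun v hv => ?_⟩
  obtain ⟨h1, h2, h3, h4⟩ := hf v hv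
  obtain ⟨k1, k2, k3, k4⟩ := hg v hv
  refine ⟨(h1.const_mul a).sub (k1.mul_const b), (h2.const_mul a).sub (k2.mul_const b),
    (h3.const_mul a).sub (k3.mul_const b), ?_⟩
  linear_combination a * h4 - b * k4

theorem phi_isBesselSol (n : ℕ) : IsBesselSol n (phi n) := by
  refine ⟨fun v => -phi (n + 1) v, phi (n + 2), fun v _ =>
    ⟨hasDerivAt_phi n v, ?_, (phi_continuous _).continuousAt, ?_⟩⟩
  · exact (hasDerivAt_phi (n + 1) v).neg.congr_deriv (neg_neg _)
  · linear_combination phi_ode n v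

/-- The operator v D² + (n+1) D + 1 sends (log v / 2) φ_n to n φ_n/(2v) - φ_{n+1}, and `sigma_ode`
cancels this up to n/(2 n! v). Half the polar part removes the remainder, which is the content of
`hp`. -/
theorem psi_isBesselSol {n : ℕ} {p' p'' : ℝ → ℝ}
    (hp : ∀ v, 0 < v → HasDerivAt (polarPart n) (p' v) v ∧ HasDerivAt p' (p'' v) v ∧
      ContinuousAt p'' v ∧
      v * p'' v + (n + 1) * p' v + polarPart n v = n / (n.factorial * v)) :
    IsBesselSol n (psi n) := by
  refine ⟨fun v => v⁻¹ / 2 * phi n v + Real.log v / 2 * (-phi (n + 1) v) + sigmaDeriv n v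
      - p' v / 2,
    fun v => ((-(v ^ 2)⁻¹) / 2 * phi n v + v⁻¹ / 2 * (-phi (n + 1) v)) +
      (v⁻¹ / 2 * (-phi (n + 1) v) + Real.log v / 2 * phi (n + 2) v) + sigmaDeriv2 n v
      - p'' v / 2, fun v hv => ?_⟩
  obtain ⟨h1, h2, h3, h4⟩ := hp v hv
  have hlog := (Real.hasDerivAt_log hv.ne').div_const 2
  have hphi1 : HasDerivAt (fun v => -phi (n + 1) v) (phi (n + 2) v) v := by
    exact (hasDerivAt_phi (n + 1) v).neg.congr_deriv (neg_neg _)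
  refine ⟨((hlog.mul (hasDerivAt_phi n v)).add (hasDerivAt_sigma n v)).sub (h1.div_const 2),
    (((((hasDerivAt_inv hv.ne').div_const 2).mul (hasDerivAt_phi n v)).add
      (hlog.mul hphi1)).add (hasDerivAt_sigmaDeriv n v)).sub (h2.div_const 2), ?_, ?_⟩
  · have c0 := (phi_continuous n).continuousAt (x := v)
    have c1 := (phi_continuous (n + 1)).continuousAt (x := v)
    have c2 := (phi_continuous (n + 2)).continuousAt (x := v)
    have c3 : ContinuousAt (sigmaDeriv2 n) v :=
      (sigmaCoeff_decay n).formalDeriv.formalDeriv.continuous.continuousAt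
    have c4 := Real.continuousAt_log hv.ne'
    have c5 : ContinuousAt (fun v : ℝ => v⁻¹) v := continuousAt_inv₀ hv.ne'
    have c6 : ContinuousAt (fun v : ℝ => (v ^ 2)⁻¹) v :=
      (continuousAt_id.pow 2).inv₀ (by simpa using hv.ne')
    fun_prop
  · have e1 := phi_ode n v
    have e2 := sigma_ode n v
    have hv' := hv.ne'
    have e3 : v * sigmaDeriv2 n v + (n + 1) * sigmaDeriv n v + sigma n v =
        phi (n + 1) v - n / (2 * v) * (phi n v - 1 / n.factorial) := by
      apply mul_left_cancel₀ hv'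
      field_simp at e2 ⊢
      linear_combination e2
    have e4 : p'' v = (n / (n.factorial * v) - (n + 1) * p' v - polarPart n v) / v := by
      field_simp
      field_simp at h4
      linear_combination h4
    have e5 : sigmaDeriv2 n v = (phi (n + 1) v - n / (2 * v) * (phi n v - 1 / n.factorial)
        - (n + 1) * sigmaDeriv n v - sigma n v) / v := by
      rw [eq_div_iff hv']; linear_combination e3
    have e6 : phi (n + 2) v = ((n + 1) * phi (n + 1) v - phi n v) / v := by
      rw [eq_div_iff hv']; linear_combination e1
    simp only [psi, e4, e5, e6]
    field_simp
    ring

theorem psi_zero_isBesselSol : IsBesselSol 0 (psi 0) :=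
  psi_isBesselSol (p' := 0) (p'' := 0) fun v _ => by
    have h : polarPart 0 = 0 := funext fun v => by simp [polarPart]
    rw [h]
    refine ⟨hasDerivAt_const _ _, hasDerivAt_const _ _, continuousAt_const, by simp⟩

theorem polarPart_three (v : ℝ) : polarPart 3 v = (2 + v + v ^ 2 / 2) / v ^ 3 := by
  simp [polarPart, Finset.sum_range_succ, Nat.factorial]
  ring

theorem psi_three_isBesselSol : IsBesselSol 3 (psi 3) := by
  refine psi_isBesselSol (p' := fun v => -(6 + 2 * v + v ^ 2 / 2) / v ^ 4)
    (p'' := fun v => (24 + 6 * v + v ^ 2) / v ^ 5) fun v hv => ?_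
  have hv' := hv.ne'
  refine ⟨?_, ?_, ?_, ?_⟩
  · rw [show polarPart 3 = fun v => (2 + v + v ^ 2 / 2) / v ^ 3 from funext polarPart_three]
    refine ((((hasDerivAt_id v).const_add 2).add ((hasDerivAt_pow 2 v).div_const 2)).div
      (hasDerivAt_pow 3 v) (by positivity)).congr_deriv ?_
    simp only [id, Pi.add_apply]
    field_simp
    ring
  · refine (((((hasDerivAt_id v).const_mul 2).const_add 6).add
      ((hasDerivAt_pow 2 v).div_const 2)).neg.div
      (hasDerivAt_pow 4 v) (by positivity)).congr_deriv ?_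
    simp only [id, Pi.add_apply, Pi.neg_apply]
    field_simp
    ring
  · exact ContinuousAt.div (by fun_prop) (by fun_prop) (by positivity)
  · rw [polarPart_three]
    simp [Nat.factorial]
    field_simp
    ring

theorem crossSol_isBesselSol {n : ℕ} (h : IsBesselSol n (psi n)) (m : ℝ) :
    IsBesselSol n (crossSol n m) :=
  h.linearComb (phi_isBesselSol n) _ _

theorem crossSol_self (n : ℕ) (m : ℝ) : crossSol n m m = 0 := by rw [crossSol]; ring

/-! ### Back to J, Y and their cross-product -/

theorem besselJ_eq (n : ℕ) (x : ℝ) : besselJ n x = (x / 2) ^ n * phi n (x ^ 2 / 4) := by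
  rw [besselJ, phi, powerSum, ← tsum_mul_left]
  refine tsum_congr fun k => ?_
  rw [phiCoeff, pow_add, pow_mul, show x ^ 2 / 4 = (x / 2) ^ 2 by ring]
  ring

theorem besselY_eq (n : ℕ) {x : ℝ} (hx : 0 < x) :
    besselY n x = 2 / Real.pi * (x / 2) ^ n *
      (psi n (x ^ 2 / 4) + Real.eulerMascheroniConstant * phi n (x ^ 2 / 4)) := by
  have hy : x ^ 2 / 4 = (x / 2) ^ 2 := by ring
  have hlog : Real.log (x ^ 2 / 4) = 2 * Real.log (x / 2) := by
    rw [hy, Real.log_pow]; push_cast; ring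
  have hpi := Real.pi_ne_zero
  have hs : ∑' k : ℕ, (((harmonic k : ℚ) : ℝ) + ((harmonic (n + k) : ℚ) : ℝ)
            - 2 * Real.eulerMascheroniConstant) *
          ((-1) ^ k / ((Nat.factorial k : ℝ) * (Nat.factorial (n + k) : ℝ)) *
            (x / 2) ^ (2 * k + n)) =
      -2 * (x / 2) ^ n * (sigma n (x ^ 2 / 4) +
        Real.eulerMascheroniConstant * phi n (x ^ 2 / 4)) := by
    have h1 : HasSum _ (sigma n (x ^ 2 / 4)) :=
      ((sigmaCoeff_decay n).summable (x ^ 2 / 4)).hasSum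
    have h2 : HasSum _ (phi n (x ^ 2 / 4)) := ((phiCoeff_decay n).summable (x ^ 2 / 4)).hasSum
    refine (hasSum_congr_of_eq
      ((h1.add (h2.mul_left Real.eulerMascheroniConstant)).mul_left (-2 * (x / 2) ^ n))
      fun k => ?_).tsum_eq
    rw [sigmaCoeff, phiCoeff, pow_add, pow_mul, hy]
    ring
  have hp : ∑ k ∈ Finset.range n,
        (Nat.factorial (n - k - 1) : ℝ) / (Nat.factorial k : ℝ) * ((x / 2) ^ (2 * k) / (x / 2) ^ n)
      = (x / 2) ^ n * polarPart n (x ^ 2 / 4) := by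
    rw [polarPart, Finset.mul_sum]
    refine Finset.sum_congr rfl fun k _ => ?_
    rw [pow_mul, hy, ← pow_mul (x / 2) 2 n, mul_comm 2 n, pow_mul (x / 2) n 2]
    field_simp
  rw [besselY, hs, hp, besselJ_eq, psi, hlog]
  field_simp
  ring

/-- Euler's constant cancels in the cross-product. -/
theorem besselCross_eq (n : ℕ) {r z : ℝ} (hr : 0 < r) (hz : 0 < z) :
    besselCross n r z = 2 / Real.pi * (r * z / 2) ^ n * (z / 2) ^ n *
      crossSol n (r ^ 2 * (z ^ 2 / 4)) (z ^ 2 / 4) := by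
  rw [besselCross, besselY_eq n hz, besselY_eq n (mul_pos hr hz), besselJ_eq, besselJ_eq, crossSol,
    show (r * z) ^ 2 / 4 = r ^ 2 * (z ^ 2 / 4) by ring]
  ring

theorem besselCross_eq_zero_iff (n : ℕ) {r z : ℝ} (hr : 0 < r) (hz : 0 < z) :
    besselCross n r z = 0 ↔ crossSol n (r ^ 2 * (z ^ 2 / 4)) (z ^ 2 / 4) = 0 := by
  rw [besselCross_eq n hr hz, mul_eq_zero, or_iff_right]
  positivity

/-! ### The Laplacian of separated functions in the plane -/

/-- The Laplacian as a sum of iterated line derivatives. -/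
theorem laplacian_eq_of_lineDeriv {u : Plane → ℝ} {x : Plane} (hu : ContDiffAt ℝ 2 u x)
    (q : Fin 2 → Plane → ℝ) (d : Fin 2 → ℝ)
    (hq : ∀ i, ∀ᶠ y in 𝓝 x, HasLineDerivAt ℝ u (q i y) y (EuclideanSpace.single i 1))
    (hd : ∀ i, HasLineDerivAt ℝ (q i) (d i) x (EuclideanSpace.single i 1)) :
    Laplacian.laplacian u x = d 0 + d 1 := by
  rw [InnerProductSpace.laplacian_eq_iteratedFDeriv_orthonormalBasis u
    (EuclideanSpace.basisFun (Fin 2) ℝ)]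
  have hdiff : ∀ᶠ y in 𝓝 x, DifferentiableAt ℝ u y :=
    (hu.eventually (by simp)).mono fun y hy => hy.differentiableAt (by simp)
  have h2 : DifferentiableAt ℝ (fderiv ℝ u) x :=
    (hu.fderiv_right (m := 1) (by norm_num)).differentiableAt (by simp)
  have key : ∀ i, iteratedFDeriv ℝ 2 u x
      ![EuclideanSpace.basisFun (Fin 2) ℝ i, EuclideanSpace.basisFun (Fin 2) ℝ i] = d i := by
    intro i
    rw [iteratedFDeriv_two_apply]
    simp only [EuclideanSpace.basisFun_apply, Matrix.cons_val_zero, Matrix.cons_val_one]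
    have e1 : (fun y => fderiv ℝ u y (EuclideanSpace.single i 1)) =ᶠ[𝓝 x] q i := by
      filter_upwards [hdiff, hq i] with y hy1 hy2
      exact (hy1.hasFDerivAt.hasLineDerivAt _).unique hy2
    have e2 := (h2.hasFDerivAt.clm_apply
      (hasFDerivAt_const (EuclideanSpace.single i (1 : ℝ)) x)).hasLineDerivAt
      (EuclideanSpace.single i 1)
    have e3 := (hd i).congr_of_eventuallyEq e1
    simpa using e2.unique e3
  simp only [Fin.sum_univ_two, key]

/-- The identification of the plane with `ℂ`. -/
noncomputable def toC : Plane →L[ℝ] ℂ :=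
  (EuclideanSpace.proj (0 : Fin 2) : Plane →L[ℝ] ℝ).smulRight (1 : ℂ) +
    (EuclideanSpace.proj (1 : Fin 2) : Plane →L[ℝ] ℝ).smulRight Complex.I

theorem toC_apply (x : Plane) : toC x = (x 0 : ℂ) + x 1 * Complex.I := by
  simp [toC, Complex.real_smul]

theorem toC_re (x : Plane) : (toC x).re = x 0 := by simp [toC_apply]

theorem toC_im (x : Plane) : (toC x).im = x 1 := by simp [toC_apply]

theorem plane_norm_sq (x : Plane) : ‖x‖ ^ 2 = x 0 ^ 2 + x 1 ^ 2 := by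
  rw [EuclideanSpace.real_norm_sq_eq, Fin.sum_univ_two]

theorem norm_toC (x : Plane) : ‖toC x‖ = ‖x‖ := by
  rw [← sq_eq_sq₀ (norm_nonneg _) (norm_nonneg _), plane_norm_sq, Complex.sq_norm,
    Complex.normSq_apply, toC_re, toC_im]
  ring

theorem hasLineDerivAt_norm_sq (y : Plane) (i : Fin 2) :
    HasLineDerivAt ℝ (fun y : Plane => ‖y‖ ^ 2) (2 * y i) y (EuclideanSpace.single i 1) := by
  have := ((hasStrictFDerivAt_norm_sq y).hasFDerivAt).hasLineDerivAt (EuclideanSpace.single i 1)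
  simpa [EuclideanSpace.inner_single_right] using this

theorem hasLineDerivAt_comp_toC {H : ℂ → ℂ} {h : ℂ} {y : Plane} (hH : HasDerivAt H h (toC y))
    (v : Plane) : HasLineDerivAt ℝ (fun y => H (toC y)) (h * toC v) y v := by
  have := ((hH.hasFDerivAt.restrictScalars ℝ).comp y toC.hasFDerivAt).hasLineDerivAt v
  simpa [Function.comp_def, mul_comm] using this

theorem hasLineDerivAt_re_comp_toC {H : ℂ → ℂ} {h : ℂ} {y : Plane}
    (hH : HasDerivAt H h (toC y)) (v : Plane) (c : ℂ) :
    HasLineDerivAt ℝ (fun y => (H (toC y) * c).re) (h * toC v * c).re y v := by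
  have h1 : HasDerivAt (fun t : ℝ => H (toC (y + t • v))) (h * toC v) 0 :=
    hasLineDerivAt_comp_toC hH v
  exact (Complex.reCLM.hasFDerivAt.comp_hasDerivAt (0 : ℝ) (h1.mul_const c))

/-- The Laplacian of a radial function times a homogeneous harmonic function. -/
theorem laplacian_radial_mul_re {G G' : ℝ → ℝ} {H H' : ℂ → ℂ} {g₂ κ : ℝ} {h₂ : ℂ} {x : Plane}
    (hu : ContDiffAt ℝ 2 (fun y : Plane => G (‖y‖ ^ 2) * (H (toC y)).re) x)
    (hG : ∀ᶠ s in 𝓝 (‖x‖ ^ 2), HasDerivAt G (G' s) s) (hG' : HasDerivAt G' g₂ (‖x‖ ^ 2))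
    (hH : ∀ᶠ w in 𝓝 (toC x), HasDerivAt H (H' w) w) (hH' : HasDerivAt H' h₂ (toC x))
    (hκ : H' (toC x) * toC x = κ * H (toC x)) :
    Laplacian.laplacian (fun y : Plane => G (‖y‖ ^ 2) * (H (toC y)).re) x =
      4 * (‖x‖ ^ 2 * g₂ + (1 + κ) * G' (‖x‖ ^ 2)) * (H (toC x)).re := by
  set e : Fin 2 → Plane := fun i => EuclideanSpace.single i 1 with he
  have hG0 : HasDerivAt G (G' (‖x‖ ^ 2)) (‖x‖ ^ 2) := hG.self_of_nhds
  have hH0 : HasDerivAt H (H' (toC x)) (toC x) := hH.self_of_nhds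
  have hxt : ∀ v : Plane, x + (0 : ℝ) • v = x := fun v => by simp
  rw [laplacian_eq_of_lineDeriv hu
    (fun i y => G' (‖y‖ ^ 2) * (2 * y i) * (H (toC y)).re +
      G (‖y‖ ^ 2) * (H' (toC y) * toC (e i)).re)
    (fun i => (g₂ * (2 * x i) * (2 * x i) + G' (‖x‖ ^ 2) * 2) * (H (toC x)).re +
      G' (‖x‖ ^ 2) * (2 * x i) * (H' (toC x) * toC (e i)).re +
      (G' (‖x‖ ^ 2) * (2 * x i) * (H' (toC x) * toC (e i)).re +
        G (‖x‖ ^ 2) * (h₂ * toC (e i) * toC (e i)).re)) ?_ ?_]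
  · have t0 : toC (e 0) = 1 := by simp [he, toC_apply]
    have t1 : toC (e 1) = Complex.I := by simp [he, toC_apply]
    -- The two `h₂` terms cancel because I² = -1, and the mixed first-order terms add up to Re(H'
    -- ζ), which Euler's relation `hκ` turns into κ Re H.
    have hκ' := congrArg Complex.re hκ
    rw [Complex.mul_re, toC_re, toC_im, Complex.re_ofReal_mul] at hκ'
    simp only [t0, t1, mul_one, mul_assoc, Complex.I_mul_I, Complex.mul_I_re, mul_neg,
      Complex.neg_re]
    rw [plane_norm_sq]
    rw [plane_norm_sq] at *
    linear_combination 4 * G' (x.ofLp 0 ^ 2 + x.ofLp 1 ^ 2) * hκ'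
  · intro i
    have c1 : ∀ᶠ y : Plane in 𝓝 x, HasDerivAt G (G' (‖y‖ ^ 2)) (‖y‖ ^ 2) :=
      (show ContinuousAt (fun y : Plane => ‖y‖ ^ 2) x by fun_prop).eventually hG
    have c2 : ∀ᶠ y : Plane in 𝓝 x, HasDerivAt H (H' (toC y)) (toC y) :=
      (show ContinuousAt toC x by fun_prop).eventually hH
    filter_upwards [c1, c2] with y hy1 hy2
    have l1 : HasDerivAt (fun t : ℝ => ‖y + t • e i‖ ^ 2) (2 * y i) 0 :=
      hasLineDerivAt_norm_sq y i
    have l2 : HasDerivAt (fun t : ℝ => (H (toC (y + t • e i))).re)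
      (H' (toC y) * toC (e i)).re 0 := by
      have := hasLineDerivAt_re_comp_toC hy2 (e i) 1
      simp only [mul_one] at this
      exact this
    have l3 := (hy1.comp_of_eq 0 l1 (by simp)).mul l2
    exact l3.congr_deriv (by simp)
  · intro i
    have l1 : HasDerivAt (fun t : ℝ => ‖x + t • e i‖ ^ 2) (2 * x i) 0 :=
      hasLineDerivAt_norm_sq x i
    have l2 : HasDerivAt (fun t : ℝ => (H (toC (x + t • e i))).re)
      (H' (toC x) * toC (e i)).re 0 := by
      have := hasLineDerivAt_re_comp_toC hH0 (e i) 1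
      simp only [mul_one] at this
      exact this
    have l3 : HasDerivAt (fun t : ℝ => (H' (toC (x + t • e i)) * toC (e i)).re)
      (h₂ * toC (e i) * toC (e i)).re 0 := hasLineDerivAt_re_comp_toC hH' (e i) (toC (e i))
    have l4 : HasDerivAt (fun t : ℝ => 2 * (x + t • e i) i) 2 0 := by
      have : (fun t : ℝ => 2 * (x + t • e i) i) = fun t => 2 * (x i + t) := by
        funext t; simp [he]
      rw [this]
      simpa using ((hasDerivAt_id (0 : ℝ)).const_add (x i)).const_mul 2
    have l5 := (((hG'.comp_of_eq 0 l1 (by simp)).mul l4).mul l2).add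
      ((hG0.comp_of_eq 0 l1 (by simp)).mul l3)
    exact l5.congr_deriv (by simp)

theorem contDiffAt_radial_mul_re {G : ℝ → ℝ} {H : ℂ → ℂ} {x : Plane}
    (hG : ContDiffAt ℝ 2 G (‖x‖ ^ 2)) (hH : ContDiffAt ℂ 2 H (toC x)) :
    ContDiffAt ℝ 2 (fun y : Plane => G (‖y‖ ^ 2) * (H (toC y)).re) x := by
  have h1 : ContDiffAt ℝ 2 (fun y : Plane => ‖y‖ ^ 2) x := (contDiff_norm_sq ℝ).contDiffAt
  have h2 : ContDiffAt ℝ 2 (fun y : Plane => H (toC y)) x :=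
    (hH.restrict_scalars ℝ).comp x toC.contDiff.contDiffAt
  exact (hG.comp x h1).mul (Complex.reCLM.contDiff.contDiffAt.comp x h2)

/-! ### Membership in the eigenspace, and eigenfunctions on the annulus -/

theorem indicator_mem_dirichletEigenspace {Ω : Set Plane} (hΩ : IsOpen Ω) {lam : ℝ}
    {F : Plane → ℝ} (hcont : ContinuousOn F (closure Ω))
    (hzero : ∀ x ∈ closure Ω, x ∉ Ω → F x = 0) (hsmooth : ∀ x ∈ Ω, ContDiffAt ℝ 2 F x)
    (hlap : ∀ x ∈ Ω, -(Laplacian.laplacian F x) = lam * F x) :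
    Ω.indicator F ∈ dirichletEigenspace Ω lam := by
  have hloc : ∀ x ∈ Ω, Ω.indicator F =ᶠ[𝓝 x] F := fun x hx => by
    filter_upwards [hΩ.mem_nhds hx] with y hy
    exact Set.indicator_of_mem hy F
  refine ⟨hcont.congr fun x hx => ?_, fun x hx => (hsmooth x hx).congr_of_eventuallyEq (hloc x hx),
    fun x hx => ?_, fun x hx => Set.indicator_of_notMem hx F⟩
  · by_cases h : x ∈ Ω
    · exact Set.indicator_of_mem h F
    · rw [Set.indicator_of_notMem h, hzero x hx h]
  · rw [(InnerProductSpace.laplacian_congr_nhds (hloc x hx)).self_of_nhds, hlap x hx,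
      Set.indicator_of_mem hx]

theorem isOpen_annulus (r : ℝ) : IsOpen (annulus r) :=
  (isOpen_lt continuous_const continuous_norm).inter (isOpen_lt continuous_norm continuous_const)

theorem closure_annulus_subset (r : ℝ) : closure (annulus r) ⊆ {x | r ≤ ‖x‖ ∧ ‖x‖ ≤ 1} :=
  closure_minimal (fun _ hx => ⟨hx.1.le, hx.2.le⟩)
    ((isClosed_le continuous_const continuous_norm).inter
      (isClosed_le continuous_norm continuous_const))

theorem contDiffAt_two_of_hasDerivAt {f f' f'' : ℝ → ℝ} {U : Set ℝ} (hU : IsOpen U)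
    (h1 : ∀ v ∈ U, HasDerivAt f (f' v) v) (h2 : ∀ v ∈ U, HasDerivAt f' (f'' v) v)
    (h3 : ContinuousOn f'' U) {v : ℝ} (hv : v ∈ U) : ContDiffAt ℝ 2 f v := by
  have k0 : ContDiffOn ℝ 0 f'' U := contDiffOn_zero.2 h3
  have k1 : ContDiffOn ℝ 1 f' U := by
    rw [show (1 : WithTop ℕ∞) = 0 + 1 by norm_num, contDiffOn_succ_iff_deriv_of_isOpen hU]
    exact ⟨fun v hv => (h2 v hv).differentiableAt.differentiableWithinAt, by simp,
      k0.congr fun v hv => (h2 v hv).deriv⟩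
  have k2 : ContDiffOn ℝ 2 f U := by
    rw [show (2 : WithTop ℕ∞) = 1 + 1 by norm_num, contDiffOn_succ_iff_deriv_of_isOpen hU]
    exact ⟨fun v hv => (h1 v hv).differentiableAt.differentiableWithinAt, by simp,
      k1.congr fun v hv => (h1 v hv).deriv⟩
  exact k2.contDiffAt (hU.mem_nhds hv)

/-- The candidate eigenfunction with radial part `f` and angular part `Re (c ζ ^ n)`. -/
noncomputable def annulusFun (f : ℝ → ℝ) (w : ℝ) (c : ℂ) (n : ℕ) (x : Plane) : ℝ :=
  f (w * ‖x‖ ^ 2) * (c * toC x ^ n).re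

/-- With s = |x|² and G(s) = f(ws), the Laplacian is 4(s G'' + (1+n) G') Re(c ζ^n), and the Bessel
equation makes this -4w times the function. The zeros of `f` at r²w and w are the boundary
conditions. -/
theorem annulusFun_mem {n : ℕ} {f : ℝ → ℝ} (hf : IsBesselSol n f) {r w : ℝ} (hr : 0 < r)
    (hw : 0 < w) (hfr : f (r ^ 2 * w) = 0) (hf1 : f w = 0) (c : ℂ) :
    (annulus r).indicator (annulusFun f w c n) ∈ dirichletEigenspace (annulus r) (4 * w) := by
  obtain ⟨f', f'', hf⟩ := hf
  set G : ℝ → ℝ := fun s => f (w * s) with hG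
  set G' : ℝ → ℝ := fun s => w * f' (w * s) with hG'
  set G'' : ℝ → ℝ := fun s => w * (w * f'' (w * s)) with hG''
  have hlin : ∀ s : ℝ, HasDerivAt (fun s => w * s) w s := fun s => by
    simpa using (hasDerivAt_id s).const_mul w
  have d1 : ∀ s ∈ Set.Ioi (0 : ℝ), HasDerivAt G (G' s) s := fun s hs => by
    have := (hf (w * s) (mul_pos hw hs)).1.comp s (hlin s)
    rwa [mul_comm] at this
  have d2 : ∀ s ∈ Set.Ioi (0 : ℝ), HasDerivAt G' (G'' s) s := fun s hs => by
    have := ((hf (w * s) (mul_pos hw hs)).2.1.comp s (hlin s)).const_mul w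
    rwa [mul_comm (f'' _) w] at this
  have d3 : ContinuousOn G'' (Set.Ioi 0) := fun s hs => by
    have h := (hf (w * s) (mul_pos hw hs)).2.2.1
    have : ContinuousAt (fun s => f'' (w * s)) s :=
      ContinuousAt.comp (f := fun s => w * s) h (by fun_prop)
    exact ((this.const_mul w).const_mul w).continuousWithinAt
  have hH : ∀ ζ : ℂ, HasDerivAt (fun ζ : ℂ => c * ζ ^ n) (c * (n * ζ ^ (n - 1))) ζ := fun ζ =>
    (hasDerivAt_pow n ζ).const_mul c
  have hH' : ∀ ζ : ℂ, HasDerivAt (fun ζ : ℂ => c * (n * ζ ^ (n - 1)))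
      (c * (n * ((n - 1 : ℕ) * ζ ^ (n - 1 - 1)))) ζ := fun ζ =>
    ((hasDerivAt_pow (n - 1) ζ).const_mul _).const_mul c
  have hpos : ∀ x ∈ annulus r, ‖x‖ ^ 2 ∈ Set.Ioi (0 : ℝ) := fun x hx =>
    pow_pos (hr.trans hx.1) 2
  have hsm : ∀ x ∈ annulus r, ContDiffAt ℝ 2 (annulusFun f w c n) x := fun x hx =>
    contDiffAt_radial_mul_re (H := fun ζ => c * ζ ^ n)
      (contDiffAt_two_of_hasDerivAt isOpen_Ioi d1 d2 d3 (hpos x hx)) (by fun_prop)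
  refine indicator_mem_dirichletEigenspace (isOpen_annulus r) ?_ ?_ hsm ?_
  · intro x hx
    have hx' := closure_annulus_subset r hx
    have hx2 : ‖x‖ ^ 2 ∈ Set.Ioi (0 : ℝ) := pow_pos (hr.trans_le hx'.1) 2
    have c1 : ContinuousAt (fun x : Plane => G (‖x‖ ^ 2)) x :=
      ContinuousAt.comp (f := fun x : Plane => ‖x‖ ^ 2) (d1 _ hx2).continuousAt (by fun_prop)
    have c2 : ContinuousAt (fun x : Plane => (c * toC x ^ n).re) x := by fun_prop
    exact (c1.mul c2).continuousWithinAt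
  · intro x hx hx2
    have hx' := closure_annulus_subset r hx
    have : ‖x‖ = r ∨ ‖x‖ = 1 := by
      by_contra h
      push Not at h
      exact hx2 ⟨lt_of_le_of_ne hx'.1 (Ne.symm h.1), lt_of_le_of_ne hx'.2 h.2⟩
    rcases this with h | h
    · rw [annulusFun, h, mul_comm w, hfr, zero_mul]
    · rw [annulusFun, h, one_pow, mul_one, hf1, zero_mul]
  · intro x hx
    have hx2 := hpos x hx
    have hl := laplacian_radial_mul_re (G := G) (G' := G') (H := fun ζ => c * ζ ^ n) (κ := n)
      (hsm x hx)
      (by filter_upwards [isOpen_Ioi.mem_nhds hx2] with s hs using d1 s hs) (d2 _ hx2)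
      (Eventually.of_forall hH) (hH' (toC x)) (by
        rcases n with _ | n
        · simp
        · simp only [Nat.add_sub_cancel]; push_cast; ring)
    change -(Laplacian.laplacian (fun y : Plane => G (‖y‖ ^ 2) * (c * toC y ^ n).re) x) =
      4 * w * (f (w * ‖x‖ ^ 2) * (c * toC x ^ n).re)
    rw [hl]
    have := (hf (w * ‖x‖ ^ 2) (mul_pos hw hx2)).2.2.2
    simp only [hG', hG'']
    linear_combination (-4 * w * (c * toC x ^ n).re) * this

/-- Three independent eigenfunctions: a radial one and a pair with angular order `n`. -/
theorem annulus_eigen {f g : ℝ → ℝ} (hf : IsBesselSol 0 f) (hg : IsBesselSol 3 g) {r w v₀ : ℝ}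
    (hr : 0 < r) (hw : 0 < w) (hfr : f (r ^ 2 * w) = 0) (hf1 : f w = 0)
    (hgr : g (r ^ 2 * w) = 0) (hg1 : g w = 0) (hv : r ^ 2 * w < v₀) (hvw : v₀ < w)
    (hf0 : f v₀ ≠ 0) (hg0 : g v₀ ≠ 0) :
    IsDirichletEigenvalue (annulus r) (4 * w) ∧
      3 ≤ dirichletMultiplicity (annulus r) (4 * w) := by
  have m0 := annulusFun_mem hf hr hw hfr hf1 1
  have m1 := annulusFun_mem hg hr hw hgr hg1 1
  have m2 := annulusFun_mem hg hr hw hgr hg1 Complex.I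
  -- The circle on which w|x|² = v₀, where both radial factors are nonzero.
  set ρ := Real.sqrt (v₀ / w) with hρ
  have hv0 : 0 < v₀ := lt_trans (by positivity) hv
  have hρ2 : ρ ^ 2 = v₀ / w := Real.sq_sqrt (by positivity)
  have hρ0 : 0 < ρ := Real.sqrt_pos.2 (by positivity)
  have hwρ : w * ρ ^ 2 = v₀ := by rw [hρ2]; field_simp
  have hρr : r < ρ := by
    rw [hρ, Real.lt_sqrt hr.le, lt_div_iff₀ hw]; exact hv
  have hρ1 : ρ < 1 := by
    rw [hρ, Real.sqrt_lt' one_pos, div_lt_iff₀ hw]; linarith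
  have hmem : ∀ x : Plane, ‖x‖ ^ 2 = ρ ^ 2 → x ∈ annulus r := fun x hx => by
    rw [sq_eq_sq₀ (norm_nonneg _) hρ0.le] at hx
    exact ⟨hx ▸ hρr, hx ▸ hρ1⟩
  -- At the angles 0, π, π/2 the pair (Re ζ³, Re iζ³) is (ρ³, 0), (-ρ³, 0), (0, ρ³). Adding the
  -- first two relations isolates `a 0`.
  set A : Plane := !₂[ρ, 0]
  set B : Plane := !₂[-ρ, 0]
  set C : Plane := !₂[0, ρ]
  have hA : ‖A‖ ^ 2 = ρ ^ 2 := by rw [plane_norm_sq]; simp [A]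
  have hB : ‖B‖ ^ 2 = ρ ^ 2 := by rw [plane_norm_sq]; simp [B]
  have hC : ‖C‖ ^ 2 = ρ ^ 2 := by rw [plane_norm_sq]; simp [C]
  have tA : toC A = ρ := by simp [toC_apply, A]
  have tB : toC B = -ρ := by simp [toC_apply, B]
  have tC : toC C = ρ * Complex.I := by simp [toC_apply, C]
  have pρ : (((ρ : ℂ)) ^ 3).re = ρ ^ 3 := by rw [← Complex.ofReal_pow, Complex.ofReal_re]
  have pρ' : (((ρ : ℂ)) ^ 3).im = 0 := by rw [← Complex.ofReal_pow, Complex.ofReal_im]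
  refine ⟨⟨_, m0, fun h => hf0 ?_⟩, ?_⟩
  · have := congrFun h A
    rw [Set.indicator_of_mem (hmem A hA), annulusFun, hA, hwρ] at this
    simpa using this
  set V : Fin 3 → dirichletEigenspace (annulus r) (4 * w) := ![⟨_, m0⟩, ⟨_, m1⟩, ⟨_, m2⟩]
  have hV : LinearIndependent ℝ V := by
    rw [Fintype.linearIndependent_iff]
    intro a ha
    have hx : ∀ x, ‖x‖ ^ 2 = ρ ^ 2 → a 0 * f v₀ + a 1 * (g v₀ * (toC x ^ 3).re) +
        a 2 * (g v₀ * (Complex.I * toC x ^ 3).re) = 0 := fun x hx => by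
      have h := congrFun (congrArg Subtype.val ha) x
      simp only [Fin.sum_univ_three, V, Matrix.cons_val_zero, Matrix.cons_val_one,
        Matrix.cons_val, Submodule.coe_add, Submodule.coe_smul, Pi.add_apply, Pi.smul_apply,
        smul_eq_mul, Set.indicator_of_mem (hmem x hx), annulusFun, hx, hwρ,
        Submodule.coe_zero, Pi.zero_apply] at h
      simpa using h
    have eA := hx A hA
    have eB := hx B hB
    have eC := hx C hC
    rw [tA, Complex.I_mul_re, pρ, pρ'] at eA
    rw [tB, Odd.neg_pow (by decide), Complex.I_mul_re, Complex.neg_re, Complex.neg_im, pρ, pρ'] at eB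
    have i3 : Complex.I ^ 3 = -Complex.I := Complex.I_pow_three
    rw [tC, mul_pow, i3, mul_neg, Complex.I_mul_re, Complex.neg_re, Complex.neg_im,
      Complex.mul_I_re, Complex.mul_I_im, pρ, pρ'] at eC
    have h0 : a 0 = 0 := by
      have : a 0 * f v₀ = 0 := by linarith
      exact (mul_eq_zero.1 this).resolve_right hf0
    have hgρ : g v₀ * ρ ^ 3 ≠ 0 := mul_ne_zero hg0 (by positivity)
    have h1 : a 1 = 0 := by
      have : a 1 * (g v₀ * ρ ^ 3) = 0 := by linarith
      exact (mul_eq_zero.1 this).resolve_right hgρ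
    have h2 : a 2 = 0 := by
      rw [h0, h1] at eC
      have : a 2 * (g v₀ * ρ ^ 3) = 0 := by linarith
      exact (mul_eq_zero.1 this).resolve_right hgρ
    intro i
    fin_cases i
    exacts [h0, h1, h2]
  have := hV.cardinal_le_rank
  simpa [dirichletMultiplicity] using this

/-! ### The slit annulus -/

/-- The open angle range (-π, π) omits just the ray of argument π, so principal powers are
holomorphic on the sector. -/
theorem annularSector_two_pi {r : ℝ} (hr : 0 < r) :
    annularSector r (2 * Real.pi) = annulus r ∩ toC ⁻¹' Complex.slitPlane := by
  have hpi : 2 * Real.pi / 2 = Real.pi := by ring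
  ext x
  constructor
  · rintro ⟨ρ, θ, h1, h2, h3, h4, rfl⟩
    rw [hpi] at h3 h4
    have hρ : 0 < ρ := hr.trans h1
    have hC : toC !₂[ρ * Real.cos θ, ρ * Real.sin θ] =
        ρ * (Complex.cos θ + Complex.sin θ * Complex.I) := by
      rw [toC_apply]; simp; ring
    have hn : ‖!₂[ρ * Real.cos θ, ρ * Real.sin θ]‖ = ρ := by
      rw [← sq_eq_sq₀ (norm_nonneg _) hρ.le, plane_norm_sq]
      simp only [Matrix.cons_val_zero, Matrix.cons_val_one]
      linear_combination ρ ^ 2 * Real.sin_sq_add_cos_sq θ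
    refine ⟨⟨by rwa [hn], by rwa [hn]⟩, ?_⟩
    rw [Set.mem_preimage, Complex.mem_slitPlane_iff_arg, hC,
      Complex.arg_mul_cos_add_sin_mul_I hρ ⟨h3, h4.le⟩]
    refine ⟨h4.ne, ?_⟩
    rw [← hC, ← norm_pos_iff, norm_toC, hn]
    exact hρ
  · rintro ⟨⟨h1, h2⟩, h3⟩
    rw [Set.mem_preimage, Complex.mem_slitPlane_iff_arg] at h3
    refine ⟨‖x‖, (toC x).arg, h1, h2, ?_, ?_, ?_⟩
    · rw [hpi]; exact Complex.neg_pi_lt_arg _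
    · rw [hpi]; exact lt_of_le_of_ne (Complex.arg_le_pi _) h3.1
    · have e0 := Complex.norm_mul_cos_arg (toC x)
      have e1 := Complex.norm_mul_sin_arg (toC x)
      rw [norm_toC] at e0 e1
      ext i
      fin_cases i
      · simp [e0, toC_re]
      · simp [e1, toC_im]

/-- `W` solves `W'' + (1 + 2κ) / t * W' + W = 0` on the positive half-line. -/
def IsRadialSol (κ : ℝ) (W : ℝ → ℝ) : Prop :=
  ∃ W' W'' : ℝ → ℝ, ∀ t, 0 < t → HasDerivAt W (W' t) t ∧ HasDerivAt W' (W'' t) t ∧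
    ContinuousAt W'' t ∧ t * W'' t + (1 + 2 * κ) * W' t + t * W t = 0

/-- The function t^κ W(t) satisfies Bessel's equation of order κ. The angular factor enters through
a separate `P` because Re ζ^κ must extend continuously by zero to the slit, which fails for general
κ; `hP`, `hP1` and `hP2` say that it does. -/
theorem slit_eigenfunction {κ : ℝ} {W : ℝ → ℝ} (hW : IsRadialSol κ W) {r z : ℝ} (hr : 0 < r)
    (hz : 0 < z) (hWr : W (z * r) = 0) (hW1 : W z = 0) {P : Plane → ℝ} (hP : Continuous P)
    (hP1 : ∀ x, toC x ∈ Complex.slitPlane → P x = (toC x ^ (κ : ℂ)).re)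
    (hP2 : ∀ x, toC x ∉ Complex.slitPlane → P x = 0) :
    (annularSector r (2 * Real.pi)).indicator (fun x => W (z * ‖x‖) * P x) ∈
      dirichletEigenspace (annularSector r (2 * Real.pi)) (z ^ 2) := by
  rw [annularSector_two_pi hr]
  set Ω := annulus r ∩ toC ⁻¹' Complex.slitPlane with hΩd
  have hΩ : IsOpen Ω :=
    (isOpen_annulus r).inter (Complex.isOpen_slitPlane.preimage toC.continuous)
  have hcl : closure Ω ⊆ {x | r ≤ ‖x‖ ∧ ‖x‖ ≤ 1} :=
    (closure_mono Set.inter_subset_left).trans (closure_annulus_subset r)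
  obtain ⟨W', W'', hW⟩ := hW
  -- The square root adapts a function of |x| to `laplacian_radial_mul_re`, which expects a function
  -- of |x|².
  set G : ℝ → ℝ := fun s => W (z * √s) with hG
  set G' : ℝ → ℝ := fun s => W' (z * √s) * (z * (1 / (2 * √s))) with hG'
  set G'' : ℝ → ℝ := fun s => W'' (z * √s) * (z * (1 / (2 * √s))) * (z * (1 / (2 * √s))) +
    W' (z * √s) * (z * (-(2 * (1 / (2 * √s))) / (2 * √s) ^ 2)) with hG''
  have hq : ∀ s ∈ Set.Ioi (0 : ℝ), HasDerivAt (fun s => z * √s) (z * (1 / (2 * √s))) s :=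
    fun s hs => (Real.hasDerivAt_sqrt (ne_of_gt hs)).const_mul z
  have hzs : ∀ s ∈ Set.Ioi (0 : ℝ), 0 < z * √s := fun s hs => mul_pos hz (Real.sqrt_pos.2 hs)
  have d1 : ∀ s ∈ Set.Ioi (0 : ℝ), HasDerivAt G (G' s) s := fun s hs =>
    (hW _ (hzs s hs)).1.comp s (hq s hs)
  have hq2 : ∀ s ∈ Set.Ioi (0 : ℝ), HasDerivAt (fun s => z * (1 / (2 * √s)))
      (z * (-(2 * (1 / (2 * √s))) / (2 * √s) ^ 2)) s := fun s hs => by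
    have h0 : (2 * √s) ≠ 0 := by have := Real.sqrt_pos.2 hs; positivity
    have := (((Real.hasDerivAt_sqrt (ne_of_gt hs)).const_mul 2).inv h0).const_mul z
    simp only [one_div] at this ⊢
    exact this
  have d2 : ∀ s ∈ Set.Ioi (0 : ℝ), HasDerivAt G' (G'' s) s := fun s hs =>
    ((hW _ (hzs s hs)).2.1.comp s (hq s hs)).mul (hq2 s hs)
  have d3 : ContinuousOn G'' (Set.Ioi 0) := fun s hs => by
    have c0 : ContinuousAt (fun s => z * √s) s := (hq s hs).continuousAt
    have c1 : ContinuousAt (fun s => W'' (z * √s)) s :=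
      ContinuousAt.comp (f := fun s => z * √s) (hW _ (hzs s hs)).2.2.1 c0
    have c2 : ContinuousAt (fun s => W' (z * √s)) s :=
      ContinuousAt.comp (f := fun s => z * √s) (hW _ (hzs s hs)).2.1.continuousAt c0
    have c3 := (hq2 s hs).continuousAt
    have hs' := Real.sqrt_pos.2 hs
    have c4 : ContinuousAt (fun s => z * (-(2 * (1 / (2 * √s))) / (2 * √s) ^ 2)) s := by
      have : (2 * √s) ^ 2 ≠ 0 := by positivity
      have h2 : 2 * √s ≠ 0 := by positivity
      fun_prop (disch := assumption)
    exact (((c1.mul c3).mul c3).add (c2.mul c4)).continuousWithinAt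
  have hFG : (fun x => W (z * ‖x‖) * P x) = fun x : Plane => G (‖x‖ ^ 2) * P x := by
    funext x; simp only [hG, Real.sqrt_sq (norm_nonneg x)]
  have hpos : ∀ x ∈ Ω, ‖x‖ ^ 2 ∈ Set.Ioi (0 : ℝ) := fun x hx => pow_pos (hr.trans hx.1.1) 2
  have hH : ∀ ζ ∈ Complex.slitPlane, HasDerivAt (fun ζ : ℂ => ζ ^ (κ : ℂ))
      (κ * ζ ^ ((κ : ℂ) - 1)) ζ := fun ζ hζ => by
    simpa using (hasDerivAt_id ζ).cpow_const (c := (κ : ℂ)) hζ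
  have hH' : ∀ ζ ∈ Complex.slitPlane, HasDerivAt (fun ζ : ℂ => κ * ζ ^ ((κ : ℂ) - 1))
      (κ * (((κ : ℂ) - 1) * ζ ^ ((κ : ℂ) - 1 - 1))) ζ := fun ζ hζ => by
    simpa using ((hasDerivAt_id ζ).cpow_const (c := (κ : ℂ) - 1) hζ).const_mul (κ : ℂ)
  have hHc : ∀ ζ ∈ Complex.slitPlane, ContDiffAt ℂ 2 (fun ζ : ℂ => ζ ^ (κ : ℂ)) ζ := fun ζ hζ =>
    (DifferentiableOn.analyticAt (s := Complex.slitPlane)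
      (fun ζ hζ => (hH ζ hζ).differentiableAt.differentiableWithinAt)
      (Complex.isOpen_slitPlane.mem_nhds hζ)).contDiffAt
  have hloc : ∀ x ∈ Ω, (fun x : Plane => G (‖x‖ ^ 2) * P x) =ᶠ[𝓝 x]
      fun x => G (‖x‖ ^ 2) * (toC x ^ (κ : ℂ)).re := fun x hx => by
    filter_upwards [hΩ.mem_nhds hx] with y hy
    rw [hP1 y hy.2]
  have hsm : ∀ x ∈ Ω, ContDiffAt ℝ 2
      (fun x : Plane => G (‖x‖ ^ 2) * (toC x ^ (κ : ℂ)).re) x := fun x hx =>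
    contDiffAt_radial_mul_re (H := fun ζ => ζ ^ (κ : ℂ))
      (contDiffAt_two_of_hasDerivAt isOpen_Ioi d1 d2 d3 (hpos x hx)) (hHc _ hx.2)
  rw [hFG]
  refine indicator_mem_dirichletEigenspace hΩ ?_ ?_
    (fun x hx => (hsm x hx).congr_of_eventuallyEq (hloc x hx)) ?_
  · intro x hx
    have hx2 : ‖x‖ ^ 2 ∈ Set.Ioi (0 : ℝ) := pow_pos (hr.trans_le (hcl hx).1) 2
    have c1 : ContinuousAt (fun x : Plane => G (‖x‖ ^ 2)) x :=
      ContinuousAt.comp (f := fun x : Plane => ‖x‖ ^ 2) (d1 _ hx2).continuousAt (by fun_prop)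
    exact (c1.mul hP.continuousAt).continuousWithinAt
  · intro x hx hx2
    have hx' := hcl hx
    by_cases hs : toC x ∈ Complex.slitPlane
    · have : ‖x‖ = r ∨ ‖x‖ = 1 := by
        by_contra h
        push Not at h
        exact hx2 ⟨⟨lt_of_le_of_ne hx'.1 (Ne.symm h.1), lt_of_le_of_ne hx'.2 h.2⟩, hs⟩
      rcases this with h | h
      · simp only [hG, Real.sqrt_sq (norm_nonneg x)]
        rw [h, hWr, zero_mul]
      · simp only [hG, Real.sqrt_sq (norm_nonneg x)]
        rw [h, mul_one, hW1, zero_mul]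
    · rw [hP2 x hs, mul_zero]
  · intro x hx
    have hx2 := hpos x hx
    have hl := laplacian_radial_mul_re (G := G) (G' := G') (H := fun ζ => ζ ^ (κ : ℂ)) (κ := κ)
      (hsm x hx) (by filter_upwards [isOpen_Ioi.mem_nhds hx2] with s hs using d1 s hs)
      (d2 _ hx2)
      (by filter_upwards [Complex.isOpen_slitPlane.mem_nhds hx.2] with ζ hζ using hH ζ hζ)
      (hH' (toC x) hx.2) (by
        rw [mul_assoc]
        congr 1
        rw [Complex.cpow_sub _ _ (Complex.slitPlane_ne_zero hx.2), Complex.cpow_one]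
        exact div_mul_cancel₀ _ (Complex.slitPlane_ne_zero hx.2))
    rw [(InnerProductSpace.laplacian_congr_nhds (hloc x hx)).self_of_nhds, hl, hP1 x hx.2]
    have hn : 0 < ‖x‖ := hr.trans hx.1.1
    have := (hW (z * ‖x‖) (mul_pos hz hn)).2.2.2
    simp only [hG, hG', hG'', Real.sqrt_sq hn.le]
    rw [mul_comm z] at this
    field_simp
    linear_combination (-(toC x ^ (κ : ℂ)).re * 4) * this

theorem slitPlane_compl_iff {x : Plane} : toC x ∉ Complex.slitPlane ↔ ‖x‖ + x 0 = 0 := by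
  have h := plane_norm_sq x
  rw [Complex.mem_slitPlane_iff, toC_re, toC_im, not_or, not_lt, not_not]
  constructor
  · rintro ⟨h0, h1⟩
    rw [h1] at h
    have : ‖x‖ = -x 0 := by
      rw [← sq_eq_sq₀ (norm_nonneg _) (by linarith)]; linarith
    linarith
  · intro h0
    have h1 : ‖x‖ = -x 0 := by linarith
    refine ⟨by linarith [norm_nonneg x], ?_⟩
    rw [h1] at h
    exact pow_eq_zero_iff two_ne_zero |>.1 (by linarith)

/-- `ρ^(1/2) cos (θ/2)` in Cartesian coordinates. -/
noncomputable def cosHalf (x : Plane) : ℝ := √((‖x‖ + x 0) / 2)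

theorem continuous_cosHalf : Continuous cosHalf := by
  unfold cosHalf; fun_prop

theorem cosHalf_eq_re (x : Plane) : cosHalf x = (toC x ^ (2⁻¹ : ℂ)).re := by
  rw [Complex.cpow_inv_two_re, norm_toC, toC_re, cosHalf]

/-- `ρ^(7/2) cos (7θ/2)` in Cartesian coordinates. -/
noncomputable def cosSevenHalves (x : Plane) : ℝ :=
  cosHalf x * (cosHalf x ^ 6 - 21 * cosHalf x ^ 4 * ((‖x‖ - x 0) / 2) +
    35 * cosHalf x ^ 2 * ((‖x‖ - x 0) / 2) ^ 2 - 7 * ((‖x‖ - x 0) / 2) ^ 3)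

theorem continuous_cosSevenHalves : Continuous cosSevenHalves := by
  have := continuous_cosHalf
  unfold cosSevenHalves; fun_prop

theorem cosHalf_sq (x : Plane) : cosHalf x ^ 2 = (‖x‖ + x 0) / 2 := by
  have h : |x 0| ≤ ‖x‖ := by
    refine abs_le_of_sq_le_sq ?_ (norm_nonneg _)
    rw [plane_norm_sq]; nlinarith [sq_nonneg (x 1)]
  exact Real.sq_sqrt (by linarith [neg_abs_le (x 0)])

/-- This is Re ψ⁷ for ψ the principal square root of ζ. Only even powers of Im ψ occur besides Re ψ,
and (Im ψ)² = (|x| - x₀)/2, so no choice of sign enters. -/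
theorem cosSevenHalves_eq_re (x : Plane) :
    cosSevenHalves x = (toC x ^ ((7 / 2 : ℝ) : ℂ)).re := by
  have e : (((7 / 2 : ℝ)) : ℂ) = (7 : ℕ) * (2⁻¹ : ℂ) := by push_cast; ring
  set ψ : ℂ := toC x ^ (2⁻¹ : ℂ) with hψ
  have h1 : ψ ^ 2 = toC x := by
    rw [hψ, ← Complex.cpow_nat_mul]; simp
  have h2 : ψ.re ^ 2 - ψ.im ^ 2 = x 0 := by
    have := congrArg Complex.re h1
    rw [toC_re, sq, Complex.mul_re] at this
    linarith
  have h3 : cosHalf x = ψ.re := cosHalf_eq_re x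
  have h4 : ψ.im ^ 2 = (‖x‖ - x 0) / 2 := by
    have := cosHalf_sq x
    rw [h3] at this
    linarith
  rw [e, Complex.cpow_nat_mul, cosSevenHalves, h3, ← h4]
  have h5 : ψ ^ 7 = (ψ.re + ψ.im * Complex.I) ^ 7 := by rw [Complex.re_add_im]
  rw [← hψ, h5]
  simp only [pow_succ, pow_zero, one_mul, Complex.mul_re, Complex.add_re, Complex.ofReal_re,
    Complex.I_re, mul_zero, Complex.ofReal_im, Complex.I_im, mul_one, sub_self, add_zero,
    Complex.add_im, Complex.mul_im, zero_add]
  ring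

/-! ### Elementary radial solutions of half-integer order -/

/-- For κ = 1/2 the equation says that tW solves y'' + y = 0. -/
theorem sin_div_isRadialSol (x : ℝ) :
    IsRadialSol (1 / 2) (fun t => Real.sin (t - x) / t) := by
  refine ⟨fun t => Real.cos (t - x) / t - Real.sin (t - x) / t ^ 2,
    fun t => -Real.sin (t - x) / t - 2 * Real.cos (t - x) / t ^ 2 + 2 * Real.sin (t - x) / t ^ 3,
    fun t ht => ?_⟩
  have ht' := ht.ne'
  have h0 : HasDerivAt (fun t => t - x) 1 t := (hasDerivAt_id t).sub_const x
  have hs := h0.sin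
  have hc := h0.cos
  refine ⟨(hs.div (hasDerivAt_id t) ht').congr_deriv ?_, ((hc.div (hasDerivAt_id t) ht').sub
    (hs.div (hasDerivAt_pow 2 t) (by positivity))).congr_deriv ?_, ?_, ?_⟩
  · simp only [id]; field_simp
  · simp only [id]; field_simp; ring
  · have h2 : t ^ 2 ≠ 0 := by positivity
    have h3 : t ^ 3 ≠ 0 := by positivity
    fun_prop (disch := assumption)
  · field_simp; ring

/-- Up to sign choices in the basis, these are the spherical Bessel functions of degree 3 divided by
t³. -/
theorem trig_isRadialSol (α β : ℝ) :
    IsRadialSol (7 / 2) (fun t =>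
      (α * ((15 - 6 * t ^ 2) * Real.sin t - (15 * t - t ^ 3) * Real.cos t) +
        β * ((15 - 6 * t ^ 2) * Real.cos t + (15 * t - t ^ 3) * Real.sin t)) / t ^ 7) := by
  refine ⟨fun t => (α * ((3 * t - t ^ 3) * Real.sin t - 3 * t ^ 2 * Real.cos t) +
      β * ((3 * t - t ^ 3) * Real.cos t + 3 * t ^ 2 * Real.sin t)) / t ^ 7 -
      7 * (α * ((15 - 6 * t ^ 2) * Real.sin t - (15 * t - t ^ 3) * Real.cos t) +
        β * ((15 - 6 * t ^ 2) * Real.cos t + (15 * t - t ^ 3) * Real.sin t)) / t ^ 8,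
    fun t => (α * (3 * Real.sin t - (3 * t + t ^ 3) * Real.cos t) +
      β * (3 * Real.cos t + (3 * t + t ^ 3) * Real.sin t)) / t ^ 7 -
      14 * (α * ((3 * t - t ^ 3) * Real.sin t - 3 * t ^ 2 * Real.cos t) +
        β * ((3 * t - t ^ 3) * Real.cos t + 3 * t ^ 2 * Real.sin t)) / t ^ 8 +
      56 * (α * ((15 - 6 * t ^ 2) * Real.sin t - (15 * t - t ^ 3) * Real.cos t) +
        β * ((15 - 6 * t ^ 2) * Real.cos t + (15 * t - t ^ 3) * Real.sin t)) / t ^ 9,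
    fun t ht => ?_⟩
  have ht' := ht.ne'
  have hs := Real.hasDerivAt_sin t
  have hc := Real.hasDerivAt_cos t
  have p2 : HasDerivAt (fun t : ℝ => 15 - 6 * t ^ 2) (-12 * t) t :=
    (((hasDerivAt_pow 2 t).const_mul 6).const_sub 15).congr_deriv (by simp; ring)
  have p3 : HasDerivAt (fun t : ℝ => 15 * t - t ^ 3) (15 - 3 * t ^ 2) t :=
    (((hasDerivAt_id t).const_mul 15).sub (hasDerivAt_pow 3 t)).congr_deriv (by simp)
  have q3 : HasDerivAt (fun t : ℝ => 3 * t - t ^ 3) (3 - 3 * t ^ 2) t :=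
    (((hasDerivAt_id t).const_mul 3).sub (hasDerivAt_pow 3 t)).congr_deriv (by simp)
  have q2 : HasDerivAt (fun t : ℝ => 3 * t ^ 2) (6 * t) t :=
    ((hasDerivAt_pow 2 t).const_mul 3).congr_deriv (by simp; ring)
  have N := ((((p2.mul hs).sub (p3.mul hc)).const_mul α).add
    (((p2.mul hc).add (p3.mul hs)).const_mul β))
  have M := ((((q3.mul hs).sub (q2.mul hc)).const_mul α).add
    (((q3.mul hc).add (q2.mul hs)).const_mul β))
  refine ⟨(N.div (hasDerivAt_pow 7 t) (by positivity)).congr_deriv ?_,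
    ((M.div (hasDerivAt_pow 7 t) (by positivity)).sub ((N.const_mul 7).div
      (hasDerivAt_pow 8 t) (by positivity))).congr_deriv ?_, ?_, ?_⟩
  · simp only [Pi.add_apply, Pi.sub_apply, Pi.mul_apply]; field_simp; ring
  · simp only [Pi.add_apply, Pi.sub_apply, Pi.mul_apply]; field_simp; ring
  · have h7 : t ^ 7 ≠ 0 := by positivity
    have h8 : t ^ 8 ≠ 0 := by positivity
    have h9 : t ^ 9 ≠ 0 := by positivity
    fun_prop (disch := assumption)
  · field_simp; ring

/-- The second product contributes at least 7 · 60 = 420, while the first is at least -150. -/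
theorem cross_poly_pos {x t : ℝ} (hx1 : 1 / 2 ≤ x) (hx2 : x ≤ 1) (t1 : 3.64 < t) (t2 : t < 4.15) :
    0 < (15 - 6 * x ^ 2) * (15 * t - t ^ 3) - (15 * x - x ^ 3) * (15 - 6 * t ^ 2) := by
  have xx : x ^ 2 ≤ 1 := by nlinarith
  have tt : t ^ 2 ≤ 17.3 := by nlinarith
  have tt' : 13 ≤ t ^ 2 := by nlinarith
  have a2 : 15 - 6 * x ^ 2 ≤ 15 := by linarith [sq_nonneg x]
  have b1 : 7 ≤ 15 * x - x ^ 3 := by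
    have e : x ^ 3 = x * x ^ 2 := by ring
    have := mul_le_mul_of_nonneg_left xx (by linarith : 0 ≤ x)
    linarith
  have b3 : -10 ≤ 15 * t - t ^ 3 := by
    have e : t ^ 3 = t * t ^ 2 := by ring
    have := mul_le_mul_of_nonneg_left tt (by linarith : 0 ≤ t)
    linarith
  have c1 : 7 * 60 ≤ (15 * x - x ^ 3) * -(15 - 6 * t ^ 2) :=
    mul_le_mul b1 (by linarith) (by norm_num) (by linarith)
  have c2 : (15 - 6 * x ^ 2) * -10 ≤ (15 - 6 * x ^ 2) * (15 * t - t ^ 3) :=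
    mul_le_mul_of_nonneg_left b3 (by linarith)
  linarith

/-- Radial solutions of orders `1/2` and `7/2` with common Dirichlet data. -/
theorem exists_radialSol_pair : ∃ (r z : ℝ) (W₁ W₂ : ℝ → ℝ), 0 < r ∧ r < 1 ∧ 0 < z ∧
    IsRadialSol (1 / 2) W₁ ∧ IsRadialSol (7 / 2) W₂ ∧
    (W₁ (z * r) = 0 ∧ W₁ z = 0) ∧ (W₂ (z * r) = 0 ∧ W₂ z = 0) ∧
    (∃ ρ, r < ρ ∧ ρ < 1 ∧ W₁ (z * ρ) ≠ 0) ∧ ∃ ρ, r < ρ ∧ ρ < 1 ∧ W₂ (z * ρ) ≠ 0 := by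
  have hpi3 := Real.pi_gt_d2
  have hpi4 := Real.pi_lt_d2
  have hpi := Real.pi_pos
  set a : ℝ → ℝ := fun t => 15 - 6 * t ^ 2 with ha
  set b : ℝ → ℝ := fun t => 15 * t - t ^ 3 with hb
  -- Sine and cosine agree at x and x + 2π, so the determinant for a common zero of an order-7/2
  -- solution at these points is this polynomial; it changes sign on [1/2, 1].
  obtain ⟨x, hx, hfx⟩ : ∃ x ∈ Set.Icc (1 / 2 : ℝ) 1,
      a x * b (x + 2 * Real.pi) - b x * a (x + 2 * Real.pi) = 0 := by
    have hc : ContinuousOn (fun x => a x * b (x + 2 * Real.pi) - b x * a (x + 2 * Real.pi))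
        (Set.Icc (1 / 2 : ℝ) 1) := by fun_prop
    refine intermediate_value_Icc (by norm_num) hc ⟨?_, ?_⟩
    · simp only [ha, hb]
      set y := 1 / 2 + 2 * Real.pi with hy
      have y1 : (67 / 10 : ℝ) < y := by rw [hy]; linarith
      nlinarith [mul_pos (sub_pos.2 y1) (sub_pos.2 y1),
        mul_pos (mul_pos (sub_pos.2 y1) (sub_pos.2 y1)) (sub_pos.2 y1)]
    · simp only [ha, hb]
      set y := 1 + 2 * Real.pi with hy
      have y1 : (7 : ℝ) < y := by rw [hy]; linarith
      have y2 : y < 8 := by rw [hy]; linarith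
      nlinarith [mul_pos (sub_pos.2 y1) (sub_pos.2 y2), mul_pos (sub_pos.2 y1) (sub_pos.2 y1),
        mul_pos (mul_pos (sub_pos.2 y1) (sub_pos.2 y2)) (sub_pos.2 y1)]
  obtain ⟨hx1, hx2⟩ := hx
  have hx0 : 0 < x := by linarith
  set y := x + 2 * Real.pi with hy
  have hy0 : 0 < y := by positivity
  set r := x / y with hr
  have hr0 : 0 < r := by positivity
  have hr1 : r < 1 := by rw [hr, div_lt_one hy0]; linarith
  have hyr : y * r = x := by rw [hr]; field_simp
  -- `S` and `C` are the numerators at `x` of the two basic solutions, so the coefficients (C, -S)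
  -- make `W₂` vanish at `x`.
  set S := a x * Real.sin x - b x * Real.cos x with hS
  set C := a x * Real.cos x + b x * Real.sin x with hC
  set W₁ : ℝ → ℝ := fun t => Real.sin (t - x) / t with hW₁
  set W₂ : ℝ → ℝ := fun t =>
    (C * ((15 - 6 * t ^ 2) * Real.sin t - (15 * t - t ^ 3) * Real.cos t) +
      -S * ((15 - 6 * t ^ 2) * Real.cos t + (15 * t - t ^ 3) * Real.sin t)) / t ^ 7 with hW₂
  have hW₂t : ∀ t, W₂ t = (C * (a t * Real.sin t - b t * Real.cos t) -
      S * (a t * Real.cos t + b t * Real.sin t)) / t ^ 7 := fun t => by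
    simp only [hW₂, ha, hb]; ring
  have hsc := Real.sin_sq_add_cos_sq x
  have n1 : W₁ (y * r) = 0 := by rw [hyr]; simp [hW₁]
  have n2 : W₁ y = 0 := by simp [hW₁, hy]
  have n3 : W₂ (y * r) = 0 := by
    rw [hyr, hW₂t, div_eq_zero_iff]; left; rw [hS, hC]; ring
  have n4 : W₂ y = 0 := by
    rw [hW₂t, div_eq_zero_iff]
    left
    rw [show Real.sin y = Real.sin x from Real.sin_add_two_pi x,
      show Real.cos y = Real.cos x from Real.cos_add_two_pi x, hS, hC]
    linear_combination -hfx + (a y * b x - b y * a x) * hsc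
  -- At x + π sine and cosine only change sign, so the value is again a polynomial determinant,
  -- settled by `cross_poly_pos`.
  have n5 : W₂ (x + Real.pi) ≠ 0 := by
    rw [hW₂t]
    refine div_ne_zero ?_ (by positivity)
    rw [Real.sin_add_pi, Real.cos_add_pi]
    set t := x + Real.pi with ht
    have e : C * (a t * -Real.sin x - b t * -Real.cos x) -
        S * (a t * -Real.cos x + b t * -Real.sin x) = a x * b t - b x * a t := by
      rw [hS, hC]; linear_combination (a x * b t - b x * a t) * hsc
    rw [e]
    have t1 : 3.64 < t := by rw [ht]; linarith
    have t2 : t < 4.15 := by rw [ht]; linarith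
    exact (cross_poly_pos hx1 hx2 t1 t2).ne'
  have n6 : W₁ (x + Real.pi / 2) ≠ 0 := by
    simp only [hW₁, add_sub_cancel_left, Real.sin_pi_div_two]; positivity
  have hpt : ∀ t, x < t → t < y → r < t / y ∧ t / y < 1 ∧ y * (t / y) = t := fun t h1 h2 =>
    ⟨by rw [hr]; gcongr, (div_lt_one hy0).2 h2, by field_simp⟩
  obtain ⟨p1, p2, p3⟩ := hpt (x + Real.pi / 2) (by linarith) (by rw [hy]; linarith)
  obtain ⟨q1, q2, q3⟩ := hpt (x + Real.pi) (by linarith) (by rw [hy]; linarith)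
  exact ⟨r, y, W₁, W₂, hr0, hr1, hy0, sin_div_isRadialSol x, trig_isRadialSol C (-S), ⟨n1, n2⟩,
    ⟨n3, n4⟩, ⟨_, p1, p2, p3.symm ▸ n6⟩, ⟨_, q1, q2, q3.symm ▸ n5⟩⟩

/-- Two independent eigenfunctions on the slit annulus. -/
theorem exists_annularSector_double_eigenvalue :
    ∃ r α lam : ℝ, 0 < r ∧ r < 1 ∧ 0 < α ∧ α ≤ 2 * Real.pi ∧
      IsDirichletEigenvalue (annularSector r α) lam ∧
      2 ≤ dirichletMultiplicity (annularSector r α) lam := by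
  obtain ⟨r, y, W₁, W₂, hr0, hr1, hy0, hW₁, hW₂, ⟨n1, n2⟩, ⟨n3, n4⟩, ⟨ρ₁, p1, p2, p3⟩,
    ⟨ρ₂, q1, q2, q3⟩⟩ := exists_radialSol_pair
  have s12 : (((1 / 2 : ℝ)) : ℂ) = 2⁻¹ := by push_cast; norm_num
  have m1 := slit_eigenfunction hW₁ hr0 hy0 n1 n2 continuous_cosHalf
    (fun p _ => by rw [cosHalf_eq_re, s12])
    (fun p hp => by rw [cosHalf, slitPlane_compl_iff.1 hp]; simp)
  have m2 := slit_eigenfunction hW₂ hr0 hy0 n3 n4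
    continuous_cosSevenHalves (fun p _ => cosSevenHalves_eq_re p)
    (fun p hp => by rw [cosSevenHalves, cosHalf, slitPlane_compl_iff.1 hp]; simp)
  refine ⟨r, 2 * Real.pi, y ^ 2, hr0, hr1, by positivity, le_rfl, ?_⟩
  set Ω := annularSector r (2 * Real.pi) with hΩ
  have hmem : ∀ p : Plane, r < ‖p‖ → ‖p‖ < 1 → toC p ∈ Complex.slitPlane → p ∈ Ω :=
    fun p h1 h2 h3 => by rw [hΩ, annularSector_two_pi hr0]; exact ⟨⟨h1, h2⟩, h3⟩
  have key : ∀ c₁ c₂ : ℝ, (∀ p ∈ Ω, c₁ * (W₁ (y * ‖p‖) * cosHalf p) +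
      c₂ * (W₂ (y * ‖p‖) * cosSevenHalves p) = 0) → ∀ ρ, r < ρ → ρ < 1 →
      c₁ * W₁ (y * ρ) = 0 ∧ c₂ * W₂ (y * ρ) = 0 := by
    intro c₁ c₂ h ρ hρr hρ1
    have hρ : 0 < ρ := hr0.trans hρr
    have h3 : √(3 : ℝ) ^ 2 = 3 := Real.sq_sqrt (by norm_num)
    -- At the angles 0 and π/3 the ratio cos(7θ/2)/cos(θ/2) is 1 and -1, which separates the two
    -- coefficients.
    set p : Plane := !₂[ρ, 0]
    set q : Plane := !₂[ρ / 2, ρ * √3 / 2]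
    have np : ‖p‖ = ρ := by
      rw [← sq_eq_sq₀ (norm_nonneg _) hρ.le, plane_norm_sq]; simp [p]
    have nq : ‖q‖ = ρ := by
      rw [← sq_eq_sq₀ (norm_nonneg _) hρ.le, plane_norm_sq]; simp [q]
      linear_combination ρ ^ 2 / 4 * h3
    have p0 : p 0 = ρ := by simp [p]
    have q0 : q 0 = ρ / 2 := by simp [q]
    have cp := cosHalf_sq p
    have cq := cosHalf_sq q
    rw [np, p0] at cp
    rw [nq, q0] at cq
    have cp0 : cosHalf p ≠ 0 := fun h => by rw [h] at cp; linarith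
    have cq0 : cosHalf q ≠ 0 := fun h => by rw [h] at cq; linarith
    have sp : cosSevenHalves p = cosHalf p * ρ ^ 3 := by
      rw [cosSevenHalves, show cosHalf p ^ 6 = (cosHalf p ^ 2) ^ 3 by ring, cp, np, p0]; ring
    have sq' : cosSevenHalves q = -(cosHalf q * ρ ^ 3) := by
      rw [cosSevenHalves, show cosHalf q ^ 6 = (cosHalf q ^ 2) ^ 3 by ring,
        show cosHalf q ^ 4 = (cosHalf q ^ 2) ^ 2 by ring, cq, nq, q0]; ring
    have ep := h p (hmem p (np ▸ hρr) (np ▸ hρ1)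
      (Or.inl (by rw [toC_re, p0]; exact hρ)))
    have eq := h q (hmem q (nq ▸ hρr) (nq ▸ hρ1)
      (Or.inl (by rw [toC_re, q0]; positivity)))
    rw [np, sp] at ep
    rw [nq, sq'] at eq
    have ep' : c₁ * W₁ (y * ρ) + c₂ * W₂ (y * ρ) * ρ ^ 3 = 0 :=
      (mul_eq_zero.1 (show cosHalf p * (c₁ * W₁ (y * ρ) + c₂ * W₂ (y * ρ) * ρ ^ 3) = 0 by
        linear_combination ep)).resolve_left cp0
    have eq' : c₁ * W₁ (y * ρ) - c₂ * W₂ (y * ρ) * ρ ^ 3 = 0 :=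
      (mul_eq_zero.1 (show cosHalf q * (c₁ * W₁ (y * ρ) - c₂ * W₂ (y * ρ) * ρ ^ 3) = 0 by
        linear_combination eq)).resolve_left cq0
    refine ⟨by linarith, ?_⟩
    exact (mul_eq_zero.1 (show c₂ * W₂ (y * ρ) * ρ ^ 3 = 0 by linarith)).resolve_right (by positivity)
  have hc₁ : ∀ c₁ : ℝ, c₁ * W₁ (y * ρ₁) = 0 → c₁ = 0 := fun c₁ h =>
    (mul_eq_zero.1 h).resolve_right p3
  have hc₂ : ∀ c₂ : ℝ, c₂ * W₂ (y * ρ₂) = 0 → c₂ = 0 := fun c₂ h =>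
    (mul_eq_zero.1 h).resolve_right q3
  refine ⟨⟨_, m1, fun h => one_ne_zero (hc₁ 1 (key 1 0 (fun p hp => ?_) _ p1 p2).1)⟩, ?_⟩
  · have := congrFun h p
    rw [Set.indicator_of_mem hp] at this
    simpa using this
  set V : Fin 2 → dirichletEigenspace Ω (y ^ 2) := ![⟨_, m1⟩, ⟨_, m2⟩]
  have hV : LinearIndependent ℝ V := by
    rw [Fintype.linearIndependent_iff]
    intro c hc
    have hall : ∀ p ∈ Ω, c 0 * (W₁ (y * ‖p‖) * cosHalf p) +
        c 1 * (W₂ (y * ‖p‖) * cosSevenHalves p) = 0 := fun p hp => by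
      have h := congrFun (congrArg Subtype.val hc) p
      simp only [Fin.sum_univ_two, V, Matrix.cons_val_zero, Matrix.cons_val_one,
        Submodule.coe_add, Submodule.coe_smul, Pi.add_apply, Pi.smul_apply,
        smul_eq_mul, Set.indicator_of_mem hp, Submodule.coe_zero, Pi.zero_apply] at h
      exact h
    have k1 := (key _ _ hall _ p1 p2).1
    have k2 := (key _ _ hall _ q1 q2).2
    intro i
    fin_cases i
    exacts [hc₁ _ k1, hc₂ _ k2]
  have := hV.cardinal_le_rank
  simpa [dirichletMultiplicity] using this

/-! ### Signs of φ_n on [0, 10.2] -/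

theorem phi_approx (n : ℕ) {w : ℝ} (hw : 0 ≤ w) (K : ℕ) (hK : w ≤ ((K : ℝ) + 1) ^ 2 / 4) :
    |phi n w - ∑ k ∈ Finset.range K, phiCoeff n k * w ^ k| ≤
      2 * ((2 * w) ^ K / (K.factorial : ℝ) ^ 2) := by
  have := (phiCoeff_decay n).abs_powerSum_sub_le K (w := w) (by rwa [abs_of_nonneg hw])
  rwa [abs_of_nonneg hw, one_mul] at this

theorem sigma_approx (n : ℕ) {w : ℝ} (hw : 0 ≤ w) (K : ℕ) (hK : w ≤ ((K : ℝ) + 1) ^ 2 / 4) :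
    |sigma n w - ∑ k ∈ Finset.range K, sigmaCoeff n k * w ^ k| ≤
      2 * ((n + 1) * (2 * w) ^ K / (K.factorial : ℝ) ^ 2) := by
  have := (sigmaCoeff_decay n).abs_powerSum_sub_le K (w := w) (by rwa [abs_of_nonneg hw])
  rwa [abs_of_nonneg hw] at this

/-- Consecutive terms of the alternating series are paired; `hn` makes every ratio less than 1. -/
theorem phi_pos_of_lt {n : ℕ} {w : ℝ} (hw : 0 ≤ w) (hn : w < n + 1) : 0 < phi n w := by
  have hs := (phiCoeff_decay n).summable w
  have he : Summable fun k : ℕ => phiCoeff n (2 * k) * w ^ (2 * k) :=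
    hs.comp_injective (mul_right_injective₀ two_ne_zero)
  have ho : Summable fun k : ℕ => phiCoeff n (2 * k + 1) * w ^ (2 * k + 1) :=
    hs.comp_injective ((add_left_injective 1).comp (mul_right_injective₀ two_ne_zero))
  have hterm : ∀ k : ℕ, phiCoeff n (2 * k) * w ^ (2 * k) + phiCoeff n (2 * k + 1) * w ^ (2 * k + 1)
      = w ^ (2 * k) / ((2 * k).factorial * (n + 2 * k).factorial) *
        (1 - w / ((2 * k + 1) * (n + 2 * k + 1))) := fun k => by
    rw [phiCoeff, phiCoeff, pow_succ (-1 : ℝ), pow_mul (-1 : ℝ), ← add_assoc, Nat.factorial_succ,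
      Nat.factorial_succ]
    push_cast
    field_simp
    ring
  have hlt : ∀ k : ℕ, w / ((2 * (k : ℝ) + 1) * (n + 2 * k + 1)) < 1 := fun k => by
    rw [div_lt_one (by positivity)]
    have hk : (0 : ℝ) ≤ k := Nat.cast_nonneg k
    have hn0 : (0 : ℝ) ≤ n := Nat.cast_nonneg n
    nlinarith [mul_nonneg hk hn0]
  have e : phi n w = ∑' k : ℕ, (phiCoeff n (2 * k) * w ^ (2 * k) +
      phiCoeff n (2 * k + 1) * w ^ (2 * k + 1)) := by
    rw [he.tsum_add ho]
    have := tsum_even_add_odd (f := fun k => phiCoeff n k * w ^ k) he ho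
    exact this.symm
  rw [e]
  refine (he.add ho).tsum_pos (fun k => ?_) 0 ?_
  · rw [hterm]
    have := hlt k
    have : 0 ≤ 1 - w / ((2 * (k : ℝ) + 1) * (n + 2 * k + 1)) := by linarith
    positivity
  · rw [hterm]
    have := hlt 0
    have : 0 < 1 - w / ((2 * ((0 : ℕ) : ℝ) + 1) * (n + 2 * ((0 : ℕ) : ℝ) + 1)) := by linarith
    rw [mul_zero, pow_zero]
    positivity

theorem phi_strictAntiOn {n : ℕ} {a b : ℝ} (h : ∀ w ∈ Set.Ioo a b, 0 < phi (n + 1) w) :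
    StrictAntiOn (phi n) (Set.Icc a b) := by
  refine strictAntiOn_of_deriv_neg (convex_Icc a b) (phi_continuous n).continuousOn fun w hw => ?_
  rw [interior_Icc] at hw
  rw [(hasDerivAt_phi n w).deriv]
  exact neg_neg_of_pos (h w hw)

theorem phi_strictMonoOn {n : ℕ} {a b : ℝ} (h : ∀ w ∈ Set.Ioo a b, phi (n + 1) w < 0) :
    StrictMonoOn (phi n) (Set.Icc a b) := by
  refine strictMonoOn_of_deriv_pos (convex_Icc a b) (phi_continuous n).continuousOn fun w hw => ?_
  rw [interior_Icc] at hw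
  rw [(hasDerivAt_phi n w).deriv]
  exact neg_pos.2 (h w hw)

/-- Since φ_n' = -φ_{n+1} < 0, the right endpoint carries the smallest value. -/
theorem phi_pos_of_succ_pos {n : ℕ} {b : ℝ} (h : ∀ w ∈ Set.Icc 0 b, 0 < phi (n + 1) w)
    (hb : 0 < phi n b) : ∀ w ∈ Set.Icc 0 b, 0 < phi n w := fun w hw =>
  hb.trans_le ((phi_strictAntiOn fun v hv => h v ⟨hv.1.le, hv.2.le⟩).antitoneOn hw
    ⟨hw.1.trans hw.2, le_rfl⟩ hw.2)

/-- Since φ_n'' = φ_{n+2} > 0, φ_n is convex and lies below its larger endpoint value. -/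
theorem phi_neg_of_convex {n : ℕ} {a b : ℝ} (h : ∀ w ∈ Set.Ioo a b, 0 < phi (n + 2) w)
    (ha : phi n a < 0) (hb : phi n b < 0) : ∀ w ∈ Set.Icc a b, phi n w < 0 := by
  intro w hw
  have hd : deriv (phi n) = fun w => -phi (n + 1) w := funext fun w => (hasDerivAt_phi n w).deriv
  have hd2 : ∀ w, HasDerivAt (fun w => -phi (n + 1) w) (phi (n + 2) w) w := fun w =>
    (hasDerivAt_phi (n + 1) w).neg.congr_deriv (neg_neg _)
  have hc : ConvexOn ℝ (Set.Icc a b) (phi n) := by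
    refine convexOn_of_deriv2_nonneg (convex_Icc a b) (phi_continuous n).continuousOn
      (fun w _ => (hasDerivAt_phi n w).differentiableAt.differentiableWithinAt) ?_ ?_
    · rw [hd]
      exact fun w _ => (hd2 w).differentiableAt.differentiableWithinAt
    · intro w hw
      rw [interior_Icc] at hw
      rw [Function.iterate_succ, Function.iterate_one, Function.comp_apply, hd, (hd2 w).deriv]
      exact (h w hw).le
  have hab : a ≤ b := hw.1.trans hw.2
  have := hc.le_max_of_mem_Icc ⟨le_rfl, hab⟩ ⟨hab, le_rfl⟩ hw
  exact this.trans_lt (max_lt ha hb)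

theorem phi_9_at_10_2 : 0.0000009 < phi 9 10.2 ∧ phi 9 10.2 < 0.0000010 := by
  have h := abs_le.1 (phi_approx 9 (w := 10.2) (by norm_num) 20 (by norm_num))
  norm_num [Finset.sum_range_succ, phiCoeff, Nat.factorial] at h
  constructor <;> norm_num <;> linarith

theorem phi_8_at_10_2 : 0.000007 < phi 8 10.2 ∧ phi 8 10.2 < 0.000008 := by
  have h := abs_le.1 (phi_approx 8 (w := 10.2) (by norm_num) 20 (by norm_num))
  norm_num [Finset.sum_range_succ, phiCoeff, Nat.factorial] at h
  constructor <;> norm_num <;> linarith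

theorem phi_7_at_10_2 : 0.000049 < phi 7 10.2 ∧ phi 7 10.2 < 0.000050 := by
  have h := abs_le.1 (phi_approx 7 (w := 10.2) (by norm_num) 20 (by norm_num))
  norm_num [Finset.sum_range_succ, phiCoeff, Nat.factorial] at h
  constructor <;> norm_num <;> linarith

theorem phi_6_at_10_2 : 0.00027 < phi 6 10.2 ∧ phi 6 10.2 < 0.00028 := by
  have h := abs_le.1 (phi_approx 6 (w := 10.2) (by norm_num) 20 (by norm_num))
  norm_num [Finset.sum_range_succ, phiCoeff, Nat.factorial] at h
  constructor <;> norm_num <;> linarith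

theorem phi_5_at_10_2 : 0.00112 < phi 5 10.2 ∧ phi 5 10.2 < 0.00113 := by
  have h := abs_le.1 (phi_approx 5 (w := 10.2) (by norm_num) 20 (by norm_num))
  norm_num [Finset.sum_range_succ, phiCoeff, Nat.factorial] at h
  constructor <;> norm_num <;> linarith

theorem phi_4_at_10_2 : 0.00285 < phi 4 10.2 ∧ phi 4 10.2 < 0.00286 := by
  have h := abs_le.1 (phi_approx 4 (w := 10.2) (by norm_num) 20 (by norm_num))
  norm_num [Finset.sum_range_succ, phiCoeff, Nat.factorial] at h
  constructor <;> norm_num <;> linarith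

theorem phi_3_at_10_2 : -0.00007 < phi 3 10.2 ∧ phi 3 10.2 < -0.00006 := by
  have h := abs_le.1 (phi_approx 3 (w := 10.2) (by norm_num) 20 (by norm_num))
  norm_num [Finset.sum_range_succ, phiCoeff, Nat.factorial] at h
  constructor <;> norm_num <;> linarith

theorem phi_2_at_10_2 : -0.0294 < phi 2 10.2 ∧ phi 2 10.2 < -0.0292 := by
  have h := abs_le.1 (phi_approx 2 (w := 10.2) (by norm_num) 20 (by norm_num))
  norm_num [Finset.sum_range_succ, phiCoeff, Nat.factorial] at h
  constructor <;> norm_num <;> linarith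

theorem phi_1_at_10_2 : -0.0580 < phi 1 10.2 ∧ phi 1 10.2 < -0.0579 := by
  have h := abs_le.1 (phi_approx 1 (w := 10.2) (by norm_num) 20 (by norm_num))
  norm_num [Finset.sum_range_succ, phiCoeff, Nat.factorial] at h
  constructor <;> norm_num <;> linarith

theorem phi_3_at_10_17 : 0.000018 < phi 3 10.17 ∧ phi 3 10.17 < 0.000020 := by
  have h := abs_le.1 (phi_approx 3 (w := 10.17) (by norm_num) 20 (by norm_num))
  norm_num [Finset.sum_range_succ, phiCoeff, Nat.factorial] at h
  constructor <;> norm_num <;> linarith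

theorem phi_2_at_6_5 : 0.00191 < phi 2 6.5 ∧ phi 2 6.5 < 0.00193 := by
  have h := abs_le.1 (phi_approx 2 (w := 6.5) (by norm_num) 20 (by norm_num))
  norm_num [Finset.sum_range_succ, phiCoeff, Nat.factorial] at h
  constructor <;> norm_num <;> linarith

theorem phi_2_at_10_17 : -0.0294 < phi 2 10.17 ∧ phi 2 10.17 < -0.0292 := by
  have h := abs_le.1 (phi_approx 2 (w := 10.17) (by norm_num) 20 (by norm_num))
  norm_num [Finset.sum_range_succ, phiCoeff, Nat.factorial] at h
  constructor <;> norm_num <;> linarith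

theorem phi_1_at_3 : 0.0879 < phi 1 3 ∧ phi 1 3 < 0.0881 := by
  have h := abs_le.1 (phi_approx 1 (w := 3) (by norm_num) 20 (by norm_num))
  norm_num [Finset.sum_range_succ, phiCoeff, Nat.factorial] at h
  constructor <;> norm_num <;> linarith

theorem phi_1_at_6_5 : -0.1323 < phi 1 6.5 ∧ phi 1 6.5 < -0.1321 := by
  have h := abs_le.1 (phi_approx 1 (w := 6.5) (by norm_num) 20 (by norm_num))
  norm_num [Finset.sum_range_succ, phiCoeff, Nat.factorial] at h
  constructor <;> norm_num <;> linarith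

theorem phi_1_at_10_17 : -0.0589 < phi 1 10.17 ∧ phi 1 10.17 < -0.0587 := by
  have h := abs_le.1 (phi_approx 1 (w := 10.17) (by norm_num) 20 (by norm_num))
  norm_num [Finset.sum_range_succ, phiCoeff, Nat.factorial] at h
  constructor <;> norm_num <;> linarith

theorem phi_0_at_3 : -0.3750 < phi 0 3 ∧ phi 0 3 < -0.3749 := by
  have h := abs_le.1 (phi_approx 0 (w := 3) (by norm_num) 20 (by norm_num))
  norm_num [Finset.sum_range_succ, phiCoeff, Nat.factorial] at h
  constructor <;> norm_num <;> linarith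

theorem phi_0_at_6_5 : -0.1447 < phi 0 6.5 ∧ phi 0 6.5 < -0.1446 := by
  have h := abs_le.1 (phi_approx 0 (w := 6.5) (by norm_num) 20 (by norm_num))
  norm_num [Finset.sum_range_succ, phiCoeff, Nat.factorial] at h
  constructor <;> norm_num <;> linarith

theorem phi_0_at_10_17 : 0.2392 < phi 0 10.17 ∧ phi 0 10.17 < 0.2393 := by
  have h := abs_le.1 (phi_approx 0 (w := 10.17) (by norm_num) 20 (by norm_num))
  norm_num [Finset.sum_range_succ, phiCoeff, Nat.factorial] at h
  constructor <;> norm_num <;> linarith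

theorem phi_0_at_0_03 : 0.970 < phi 0 0.03 ∧ phi 0 0.03 < 0.971 := by
  have h := abs_le.1 (phi_approx 0 (w := 0.03) (by norm_num) 6 (by norm_num))
  norm_num [Finset.sum_range_succ, phiCoeff, Nat.factorial] at h
  constructor <;> norm_num <;> linarith

theorem phi_0_at_1 : 0.223 < phi 0 1 ∧ phi 0 1 < 0.225 := by
  have h := abs_le.1 (phi_approx 0 (w := 1) (by norm_num) 6 (by norm_num))
  norm_num [Finset.sum_range_succ, phiCoeff, Nat.factorial] at h
  constructor <;> norm_num <;> linarith

theorem phi_3_at_1 : 0.128 < phi 3 1 ∧ phi 3 1 < 0.130 := by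
  have h := abs_le.1 (phi_approx 3 (w := 1) (by norm_num) 6 (by norm_num))
  norm_num [Finset.sum_range_succ, phiCoeff, Nat.factorial] at h
  constructor <;> norm_num <;> linarith

/-- Descent from φ_10, positive here because 10.2 < 11, with one evaluation at 10.2 for each order.
-/
theorem phi_five_pos : ∀ w ∈ Set.Icc (0 : ℝ) 10.2, 0 < phi 5 w := by
  have h9 := phi_pos_of_succ_pos (n := 9) (b := 10.2)
    (fun w hw => phi_pos_of_lt hw.1 (by have := hw.2; norm_num at this ⊢; linarith))
    (by have := phi_9_at_10_2.1; norm_num at this ⊢; linarith)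
  have h8 := phi_pos_of_succ_pos h9 (by have := phi_8_at_10_2.1; norm_num at this ⊢; linarith)
  have h7 := phi_pos_of_succ_pos h8 (by have := phi_7_at_10_2.1; norm_num at this ⊢; linarith)
  have h6 := phi_pos_of_succ_pos h7 (by have := phi_6_at_10_2.1; norm_num at this ⊢; linarith)
  exact phi_pos_of_succ_pos h6 (by have := phi_5_at_10_2.1; norm_num at this ⊢; linarith)

theorem phi_four_pos : ∀ w ∈ Set.Icc (0 : ℝ) 10.2, 0 < phi 4 w :=
  phi_pos_of_succ_pos phi_five_pos (by have := phi_4_at_10_2.1; norm_num at this ⊢; linarith)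

theorem phi_three_pos : ∀ w ∈ Set.Icc (0 : ℝ) 10.17, 0 < phi 3 w :=
  phi_pos_of_succ_pos (fun w hw => phi_four_pos w ⟨hw.1, by linarith [hw.2]⟩)
    (by have := phi_3_at_10_17.1; norm_num at this ⊢; linarith)

theorem phi_two_pos : ∀ w ∈ Set.Icc (0 : ℝ) 6.5, 0 < phi 2 w :=
  phi_pos_of_succ_pos (fun w hw => phi_three_pos w ⟨hw.1, by linarith [hw.2]⟩)
    (by have := phi_2_at_6_5.1; norm_num at this ⊢; linarith)

theorem phi_one_pos : ∀ w ∈ Set.Icc (0 : ℝ) 3, 0 < phi 1 w :=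
  phi_pos_of_succ_pos (fun w hw => phi_two_pos w ⟨hw.1, by linarith [hw.2]⟩)
    (by have := phi_1_at_3.1; norm_num at this ⊢; linarith)

theorem phi_two_neg : ∀ w ∈ Set.Icc (10.17 : ℝ) 10.2, phi 2 w < 0 :=
  phi_neg_of_convex (fun w hw => phi_four_pos w ⟨by linarith [hw.1], hw.2.le⟩)
    (by linarith [phi_2_at_10_17.2]) (by linarith [phi_2_at_10_2.2])

/-- Up to 10.17 convexity applies because φ_3 > 0. Beyond it φ_3 may change sign, but φ_2 < 0 makes
φ_1 increase to its negative value at 10.2. -/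
theorem phi_one_neg : ∀ w ∈ Set.Icc (6.5 : ℝ) 10.2, phi 1 w < 0 := by
  intro w hw
  rcases le_total w 10.17 with h | h
  · exact phi_neg_of_convex (fun w hw => phi_three_pos w ⟨by linarith [hw.1], hw.2.le⟩)
      (by linarith [phi_1_at_6_5.2]) (by linarith [phi_1_at_10_17.2]) w ⟨hw.1, h⟩
  · have hm : StrictMonoOn (phi 1) (Set.Icc 10.17 10.2) :=
      phi_strictMonoOn fun w hw => phi_two_neg w ⟨hw.1.le, hw.2.le⟩
    have := hm.monotoneOn (a := w) (b := 10.2) ⟨h, hw.2⟩ ⟨by norm_num, le_rfl⟩ hw.2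
    linarith [phi_1_at_10_2.2]

theorem phi_zero_strictAntiOn : StrictAntiOn (phi 0) (Set.Icc 0 3) :=
  phi_strictAntiOn fun w hw => phi_one_pos w ⟨hw.1.le, hw.2.le⟩

theorem phi_zero_strictMonoOn : StrictMonoOn (phi 0) (Set.Icc 6.5 10.2) :=
  phi_strictMonoOn fun w hw => phi_one_neg w ⟨hw.1.le, hw.2.le⟩

theorem phi_zero_neg : ∀ w ∈ Set.Icc (3 : ℝ) 6.5, phi 0 w < 0 :=
  phi_neg_of_convex (fun w hw => phi_two_pos w ⟨by linarith [hw.1], hw.2.le⟩)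
    (by linarith [phi_0_at_3.2]) (by linarith [phi_0_at_6_5.2])

theorem phi_at_zero (n : ℕ) : phi n 0 = 1 / n.factorial := by
  rw [phi, powerSum, tsum_eq_single 0 fun k hk => by simp [hk]]
  simp [phiCoeff]

/-! ### Order zero: zeros of J_0, the Wronskian, and counting zeros -/

/-- The first two zeros of `J_0`, in the variable `x²/4`. -/
theorem exists_phi_zero_zeros : ∃ w₁ w₂ : ℝ, 0 < w₁ ∧ w₁ < 3 ∧ 6.5 < w₂ ∧ w₂ < 10.17 ∧
    phi 0 w₁ = 0 ∧ phi 0 w₂ = 0 ∧ (∀ w, 0 ≤ w → w < w₁ → 0 < phi 0 w) ∧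
    (∀ w, w₁ < w → w < w₂ → phi 0 w < 0) ∧ ∀ w, w₂ < w → w ≤ 10.2 → 0 < phi 0 w := by
  have c0 := (phi_continuous 0).continuousOn (s := Set.Icc (0 : ℝ) 3)
  have c1 := (phi_continuous 0).continuousOn (s := Set.Icc (6.5 : ℝ) 10.17)
  obtain ⟨w₁, h1, e1⟩ := intermediate_value_Ioo' (by norm_num) c0
    (show (0 : ℝ) ∈ _ from ⟨by linarith [phi_0_at_3.2], by rw [phi_at_zero]; norm_num⟩)
  obtain ⟨w₂, h2, e2⟩ := intermediate_value_Ioo (by norm_num) c1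
    (show (0 : ℝ) ∈ _ from ⟨by linarith [phi_0_at_6_5.2], by linarith [phi_0_at_10_17.1]⟩)
  refine ⟨w₁, w₂, h1.1, h1.2, h2.1, h2.2, e1, e2, fun w a b => ?_, fun w a b => ?_, fun w a b => ?_⟩
  · rw [← e1]
    exact phi_zero_strictAntiOn ⟨a, by linarith [h1.2]⟩ ⟨h1.1.le, h1.2.le⟩ b
  · rcases le_total w 3 with h | h
    · rw [← e1]
      exact phi_zero_strictAntiOn ⟨h1.1.le, h1.2.le⟩ ⟨by linarith [h1.1], h⟩ a
    rcases le_total w 6.5 with h' | h'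
    · exact phi_zero_neg w ⟨h, h'⟩
    · rw [← e2]
      exact phi_zero_strictMonoOn ⟨h', by linarith [h2.2]⟩ ⟨h2.1.le, by linarith [h2.2]⟩ b
  · rw [← e2]
    exact phi_zero_strictMonoOn ⟨h2.1.le, by linarith [h2.2]⟩ ⟨by linarith [h2.1], b⟩ a

/-- The energy `J_0² + J_1²` decreases. -/
theorem energy_antitoneOn :
    AntitoneOn (fun w => phi 0 w ^ 2 + w * phi 1 w ^ 2) (Set.Ici 0) := by
  have hd : ∀ w, HasDerivAt (fun w => phi 0 w ^ 2 + w * phi 1 w ^ 2) (-(phi 1 w ^ 2)) w := by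
    intro w
    have h0 := hasDerivAt_phi 0 w
    have h1 := hasDerivAt_phi 1 w
    refine ((h0.pow 2).add ((hasDerivAt_id w).mul (h1.pow 2))).congr_deriv ?_
    have := phi_ode 0 w
    simp only [id, Pi.pow_apply, CharP.cast_eq_zero, zero_add, one_mul] at this ⊢
    push_cast
    linear_combination (-2 * phi 1 w) * this
  refine antitoneOn_of_deriv_nonpos (convex_Ici 0)
    (fun w _ => (hd w).continuousAt.continuousWithinAt)
    (fun w _ => (hd w).differentiableAt.differentiableWithinAt) fun w _ => ?_
  rw [(hd w).deriv]
  exact neg_nonpos.2 (sq_nonneg _)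

/-- On [0, 3] φ_0 decreases from near 1 to about -0.375. Past 3 the energy, which is small there,
keeps |φ_0| below 0.9. -/
theorem abs_phi_zero_lt {m w : ℝ} (hm : 0 ≤ m) (hm' : m ≤ 0.03) (hmw : m < w) (hw : w ≤ 10.2) :
    |phi 0 w| < phi 0 m := by
  have hm1 : 0.9 < phi 0 m := by
    have := phi_zero_strictAntiOn.antitoneOn (a := m) (b := 0.03) ⟨hm, by linarith⟩
      ⟨by norm_num, by norm_num⟩ hm'
    linarith [phi_0_at_0_03.1]
  rcases le_total w 3 with h | h
  · refine abs_lt.2 ⟨?_, phi_zero_strictAntiOn ⟨hm, hmw.le.trans h⟩ ⟨hm.trans hmw.le, h⟩ hmw⟩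
    have := phi_zero_strictAntiOn.antitoneOn (a := w) (b := 3) ⟨hm.trans hmw.le, h⟩
      ⟨by norm_num, le_rfl⟩ h
    linarith [phi_0_at_3.1]
  · have := energy_antitoneOn (a := 3) (b := w) (by simp) (by simp; linarith) h
    simp only at this
    have h2 : phi 0 w ^ 2 ≤ 0.9 ^ 2 := by
      have p0 := phi_0_at_3
      have p1 := phi_1_at_3
      have k0 : 0 ≤ w * phi 1 w ^ 2 := mul_nonneg (by linarith) (sq_nonneg _)
      have k1 : phi 0 3 ^ 2 ≤ 0.4 ^ 2 := sq_le_sq' (by linarith) (by linarith)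
      have k2 : phi 1 3 ^ 2 ≤ 0.1 ^ 2 := sq_le_sq' (by linarith) (by linarith)
      norm_num at k1 k2 ⊢
      linarith
    exact (abs_le_of_sq_le_sq h2 (by norm_num)).trans_lt hm1

/-- Off 0 the factor w in `sigma_ode` is cancelled; continuity supplies w = 0. -/
theorem sigma_zero_ode (w : ℝ) :
    w * sigmaDeriv2 0 w + sigmaDeriv 0 w + sigma 0 w = phi 1 w := by
  have h : ∀ v : ℝ, v ≠ 0 → v * sigmaDeriv2 0 v + sigmaDeriv 0 v + sigma 0 v = phi 1 v :=
    fun v hv => by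
      have := sigma_ode 0 v
      simp only [CharP.cast_eq_zero, zero_div, zero_mul, neg_zero, zero_add, one_mul,
        mul_eq_zero, hv, false_or] at this
      linarith
  have c2 : Continuous (sigmaDeriv2 0) := (sigmaCoeff_decay 0).formalDeriv.formalDeriv.continuous
  have c1 : Continuous (sigmaDeriv 0) := (sigmaCoeff_decay 0).formalDeriv.continuous
  have c0 := sigma_continuous 0
  have e := Continuous.ext_on (dense_compl_singleton (0 : ℝ))
    (f := fun v => v * sigmaDeriv2 0 v + sigmaDeriv 0 v + sigma 0 v) (g := phi 1)
    (by fun_prop) (phi_continuous 1) (fun v hv => h v hv)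
  exact congrFun e w

/-- The Wronskian of the two solutions of order zero. -/
theorem wronskian_zero (w : ℝ) :
    w * (phi 0 w * sigmaDeriv 0 w + sigma 0 w * phi 1 w) = (1 - phi 0 w ^ 2) / 2 := by
  have hd : ∀ w, HasDerivAt (fun w => w * (phi 0 w * sigmaDeriv 0 w + sigma 0 w * phi 1 w) +
      phi 0 w ^ 2 / 2) 0 w := fun w => by
    have h0 := hasDerivAt_phi 0 w
    have h1 := hasDerivAt_phi 1 w
    have s0 := hasDerivAt_sigma 0 w
    have s1 := hasDerivAt_sigmaDeriv 0 w
    refine (((hasDerivAt_id w).mul ((h0.mul s1).add (s0.mul h1))).add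
      ((h0.pow 2).div_const 2)).congr_deriv ?_
    have e1 := phi_ode 0 w
    have e2 : w * sigmaDeriv2 0 w + sigmaDeriv 0 w + sigma 0 w = phi 1 w := by
      have := sigma_zero_ode w
      linarith
    simp only [id, Pi.add_apply, Pi.mul_apply, CharP.cast_eq_zero, zero_add, one_mul] at e1 ⊢
    push_cast
    linear_combination phi 0 w * e2 - sigma 0 w * e1
  have hc := is_const_of_deriv_eq_zero (fun w => (hd w).differentiableAt) (fun w => (hd w).deriv) w 0
  simp only [phi_at_zero] at hc
  norm_num at hc
  linarith

/-- The logarithm-free form of `crossSol` of order zero. -/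
theorem crossSol_zero_eq {r w : ℝ} (hr : 0 < r) (hw : 0 < w) :
    crossSol 0 (r ^ 2 * w) w = -Real.log r * (phi 0 (r ^ 2 * w) * phi 0 w) +
      phi 0 (r ^ 2 * w) * sigma 0 w - phi 0 w * sigma 0 (r ^ 2 * w) := by
  have hl : Real.log (r ^ 2 * w) = 2 * Real.log r + Real.log w := by
    rw [Real.log_mul (by positivity) hw.ne', Real.log_pow]; push_cast; ring
  have hp : ∀ v, polarPart 0 v = 0 := fun v => by simp [polarPart]
  rw [crossSol, psi, psi, hl, hp, hp]
  ring

/-- The quotient of `crossSol` of order zero by `φ_0(r² w) φ_0(w)`. -/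
noncomputable def crossQuot (r w : ℝ) : ℝ :=
  -Real.log r + sigma 0 w / phi 0 w - sigma 0 (r ^ 2 * w) / phi 0 (r ^ 2 * w)

theorem crossSol_eq_crossQuot {r w : ℝ} (hr : 0 < r) (hw : 0 < w) (h : phi 0 w ≠ 0)
    (hm : phi 0 (r ^ 2 * w) ≠ 0) :
    crossSol 0 (r ^ 2 * w) w = phi 0 (r ^ 2 * w) * phi 0 w * crossQuot r w := by
  rw [crossSol_zero_eq hr hw, crossQuot]
  field_simp

theorem hasDerivAt_sigma_div_phi {w : ℝ} (hw : 0 < w) (h : phi 0 w ≠ 0) :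
    HasDerivAt (fun w => sigma 0 w / phi 0 w) ((1 - phi 0 w ^ 2) / (2 * w * phi 0 w ^ 2)) w := by
  refine ((hasDerivAt_sigma 0 w).div (hasDerivAt_phi 0 w) h).congr_deriv ?_
  have := wronskian_zero w
  field_simp
  linear_combination 2 * this

theorem sq_mul_bounds {r w : ℝ} (hr : 0 < r) (hr' : r ≤ 0.05) (hw : 0 < w) (hw' : w ≤ 10.2) :
    0 ≤ r ^ 2 * w ∧ r ^ 2 * w ≤ 0.03 ∧ r ^ 2 * w < w := by
  have : r ^ 2 ≤ 0.0025 := by nlinarith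
  refine ⟨by positivity, by nlinarith, by nlinarith⟩

theorem phi_zero_pos_of_small {m : ℝ} (hm : 0 ≤ m) (hm' : m ≤ 0.03) : 0 < phi 0 m :=
  (abs_nonneg _).trans_lt (abs_phi_zero_lt hm hm' (w := 1) (by linarith) (by norm_num))

/-- `crossQuot` increases on every interval free of zeros of `φ_0`. -/
theorem crossQuot_strictMonoOn {r : ℝ} (hr : 0 < r) (hr' : r ≤ 0.05) {s : Set ℝ}
    (hs : Convex ℝ s) (hs' : s ⊆ Set.Ioc 0 10.2) (h : ∀ w ∈ s, phi 0 w ≠ 0) :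
    StrictMonoOn (crossQuot r) s := by
  have hd : ∀ w ∈ s, HasDerivAt (crossQuot r) ((1 - phi 0 w ^ 2) / (2 * w * phi 0 w ^ 2) -
      (1 - phi 0 (r ^ 2 * w) ^ 2) / (2 * w * phi 0 (r ^ 2 * w) ^ 2)) w := fun w hw => by
    obtain ⟨h1, h2⟩ := hs' hw
    obtain ⟨b1, b2, b3⟩ := sq_mul_bounds hr hr' h1 h2
    have hm := (phi_zero_pos_of_small b1 b2).ne'
    have d1 := hasDerivAt_sigma_div_phi h1 (h w hw)
    have d2 := (hasDerivAt_sigma_div_phi (mul_pos (pow_pos hr 2) h1) hm).comp w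
      ((hasDerivAt_id w).const_mul (r ^ 2))
    refine ((d1.const_add (-Real.log r)).sub d2).congr_deriv ?_
    have hr2 := hr.ne'
    have hw' := h1.ne'
    field_simp
  refine strictMonoOn_of_deriv_pos hs (fun w hw => (hd w hw).continuousAt.continuousWithinAt)
    fun w hw => ?_
  have hw := interior_subset hw
  obtain ⟨h1, h2⟩ := hs' hw
  obtain ⟨b1, b2, b3⟩ := sq_mul_bounds hr hr' h1 h2
  have hm := phi_zero_pos_of_small b1 b2
  -- The derivative has the sign of φ_0(r²w)² - φ_0(w)², so this comparison decides it.
  have hlt := abs_phi_zero_lt b1 b2 b3 h2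
  have hlt2 : phi 0 w ^ 2 < phi 0 (r ^ 2 * w) ^ 2 := sq_lt_sq.2 (by rwa [abs_of_pos hm])
  have hpw : 0 < phi 0 w ^ 2 := pow_two_pos_of_ne_zero (h w hw)
  rw [(hd w hw).deriv]
  have e : (1 - phi 0 w ^ 2) / (2 * w * phi 0 w ^ 2) -
      (1 - phi 0 (r ^ 2 * w) ^ 2) / (2 * w * phi 0 (r ^ 2 * w) ^ 2) =
      (phi 0 (r ^ 2 * w) ^ 2 - phi 0 w ^ 2) / (2 * w * (phi 0 w ^ 2 * phi 0 (r ^ 2 * w) ^ 2)) := by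
    have hM := hm.ne'
    have hw0 := h w hw
    generalize phi 0 (r ^ 2 * w) = M at hM
    field_simp
    ring
  rw [e]
  exact div_pos (by linarith) (by positivity)

theorem continuous_crossZero (r : ℝ) : Continuous fun w =>
    -Real.log r * (phi 0 (r ^ 2 * w) * phi 0 w) +
      phi 0 (r ^ 2 * w) * sigma 0 w - phi 0 w * sigma 0 (r ^ 2 * w) := by
  have h1 := phi_continuous 0
  have h2 := sigma_continuous 0
  fun_prop

/-- At a zero of φ_0 the Wronskian identity leaves w σ_0 φ_1 = 1/2. -/
theorem sigma_ne_zero_sign {w : ℝ} (hw : 0 < w) (h : phi 0 w = 0) :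
    0 < sigma 0 w * phi 1 w := by
  have := wronskian_zero w
  rw [h] at this
  have : w * (sigma 0 w * phi 1 w) = 1 / 2 := by linarith
  by_contra hn
  nlinarith

theorem sigma_div_phi_strictMonoOn {b : ℝ} (hb : b ≤ 10.2)
    (h : ∀ w, 0 ≤ w → w < b → 0 < phi 0 w) :
    StrictMonoOn (fun w => sigma 0 w / phi 0 w) (Set.Ico 0 b) := by
  refine strictMonoOn_of_deriv_pos (convex_Ico _ _) ((sigma_continuous 0).continuousOn.div
    (phi_continuous 0).continuousOn fun x hx => (h x hx.1 hx.2).ne') fun x hx => ?_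
  rw [interior_Ico] at hx
  have hx0 := h x hx.1.le hx.2
  rw [(hasDerivAt_sigma_div_phi hx.1 hx0.ne').deriv]
  have hlt := abs_phi_zero_lt le_rfl (by norm_num) hx.1 (by linarith [hx.2])
  rw [phi_at_zero, abs_of_pos hx0] at hlt
  norm_num at hlt
  have h2 : phi 0 x ^ 2 < 1 := by nlinarith
  have hx1 := hx.1
  exact div_pos (by linarith) (by positivity)

/-- A zero beyond `10.17` is the second one. -/
theorem isNthPosZero_besselCross_zero {r w : ℝ} (hr : 0 < r) (hr' : r ≤ 0.05) (hw : 10.17 ≤ w)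
    (hw' : w ≤ 10.2) (h : crossSol 0 (r ^ 2 * w) w = 0) :
    IsNthPosZero (besselCross 0 r) 2 (2 * √w) := by
  obtain ⟨w₁, w₂, h10, h13, h26, h21, e1, e2, p1, p2, p3⟩ := exists_phi_zero_zeros
  have hw0 : 0 < w := by linarith
  have hm : ∀ v, 0 < v → v ≤ 10.2 → 0 < phi 0 (r ^ 2 * v) := fun v hv hv' => by
    obtain ⟨b1, b2, b3⟩ := sq_mul_bounds hr hr' hv hv'
    exact phi_zero_pos_of_small b1 b2
  have cross_zero_iff : ∀ v, 0 < v → v ≤ 10.2 → phi 0 v ≠ 0 →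
      (crossSol 0 (r ^ 2 * v) v = 0 ↔ crossQuot r v = 0) := fun v hv hv' hne => by
    rw [crossSol_eq_crossQuot hr hv hne (hm v hv hv').ne', mul_eq_zero,
      or_iff_right (mul_ne_zero (hm v hv hv').ne' hne)]
  -- At zeros of φ_0 the cross-product is φ_0(r²w) σ_0(w), so the signs of σ_0 at w₁ and w₂ exclude
  -- these points and force a zero between them.
  have s1 : 0 < sigma 0 w₁ :=
    pos_of_mul_pos_left (sigma_ne_zero_sign h10 e1) (phi_one_pos w₁ ⟨h10.le, h13.le⟩).le
  have s2 : sigma 0 w₂ < 0 := by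
    have a := sigma_ne_zero_sign (by linarith) e2
    have b := phi_one_neg w₂ ⟨h26.le, by linarith⟩
    by_contra hn
    nlinarith
  have g1 : 0 < crossSol 0 (r ^ 2 * w₁) w₁ := by
    rw [crossSol_zero_eq hr h10, e1]
    have := mul_pos (hm w₁ h10 (by linarith)) s1
    linarith
  have g2 : crossSol 0 (r ^ 2 * w₂) w₂ < 0 := by
    rw [crossSol_zero_eq hr (by linarith), e2]
    have := mul_neg_of_pos_of_neg (hm w₂ (by linarith) (by linarith)) s2
    linarith
  obtain ⟨v, hv, hv0⟩ : ∃ v ∈ Set.Ioo w₁ w₂, crossSol 0 (r ^ 2 * v) v = 0 := by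
    obtain ⟨v, hv, hv0⟩ := intermediate_value_Ioo' (by linarith : w₁ ≤ w₂)
      (continuous_crossZero r).continuousOn (show (0 : ℝ) ∈ _ from
        ⟨by rw [← crossSol_zero_eq hr (by linarith)]; exact g2,
          by rw [← crossSol_zero_eq hr h10]; exact g1⟩)
    exact ⟨v, hv, by rw [crossSol_zero_eq hr (by linarith [hv.1])]; exact hv0⟩
  have mid : StrictMonoOn (crossQuot r) (Set.Ioo w₁ w₂) :=
    crossQuot_strictMonoOn hr hr' (convex_Ioo _ _)
      (fun x hx => ⟨by linarith [hx.1], by linarith [hx.2]⟩) fun x hx => (p2 x hx.1 hx.2).ne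
  have last : StrictMonoOn (crossQuot r) (Set.Ioc w₂ 10.2) :=
    crossQuot_strictMonoOn hr hr' (convex_Ioc _ _)
      (fun x hx => ⟨by linarith [hx.1], hx.2⟩) fun x hx => (p3 x hx.1 hx.2).ne'
  have first := sigma_div_phi_strictMonoOn (by linarith) p1
  have only : ∀ x, 0 < x → x ≤ w → crossSol 0 (r ^ 2 * x) x = 0 → x = v ∨ x = w := by
    intro x hx hxw hx0
    rcases lt_trichotomy x w₁ with hlt | heq | hgt
    -- Before w₁ the quotient is -log r plus an increment of the increasing function σ_0/φ_0 from
    -- r²x to x, hence positive.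
    · exfalso
      have hpx := p1 x hx.le hlt
      obtain ⟨b1, b2, b3⟩ := sq_mul_bounds hr hr' hx (hxw.trans hw')
      rw [cross_zero_iff x hx (hxw.trans hw') hpx.ne', crossQuot] at hx0
      have := first ⟨b1, b3.trans hlt⟩ ⟨hx.le, hlt⟩ b3
      have hl : Real.log r < 0 := Real.log_neg hr (by linarith)
      simp only at this
      linarith
    · rw [heq] at hx0; exact absurd hx0 g1.ne'
    rcases lt_trichotomy x w₂ with hlt | heq | hgt'
    · left
      rw [cross_zero_iff x hx (hxw.trans hw') (p2 x hgt hlt).ne] at hx0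
      rw [cross_zero_iff v (by linarith [hv.1]) (by linarith [hv.2])
        (p2 v hv.1 hv.2).ne] at hv0
      exact mid.injOn ⟨hgt, hlt⟩ hv (hx0.trans hv0.symm)
    · rw [heq] at hx0; exact absurd hx0 g2.ne
    · right
      rw [cross_zero_iff x hx (hxw.trans hw') (p3 x hgt' (hxw.trans hw')).ne'] at hx0
      rw [cross_zero_iff w hw0 hw' (p3 w (by linarith) hw').ne'] at h
      exact last.injOn ⟨hgt', hxw.trans hw'⟩ ⟨by linarith, hw'⟩ (hx0.trans h.symm)
  have hv0' : 0 < v := by linarith [hv.1]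
  have hsq : ∀ x : ℝ, 0 ≤ x → (2 * √x) ^ 2 / 4 = x := fun x hx => by
    rw [mul_pow, Real.sq_sqrt hx]; ring
  have hcz : ∀ x, 0 < x → (besselCross 0 r (2 * √x) = 0 ↔ crossSol 0 (r ^ 2 * x) x = 0) :=
    fun x hx => by
      rw [besselCross_eq_zero_iff 0 hr (by have := Real.sqrt_pos.2 hx; positivity), hsq x hx.le]
  have hvw : 2 * √v < 2 * √w := by
    have := Real.sqrt_lt_sqrt hv0'.le (show v < w by linarith [hv.2])
    linarith
  refine ⟨by have := Real.sqrt_pos.2 hw0; positivity, (hcz w hw0).2 h, ?_⟩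
  have hset : {z : ℝ | 0 < z ∧ z ≤ 2 * √w ∧ besselCross 0 r z = 0} = {2 * √v, 2 * √w} := by
    ext z
    constructor
    · rintro ⟨hz, hzw, hz0⟩
      have hz4 : 0 < z ^ 2 / 4 := by positivity
      have ez : 2 * √(z ^ 2 / 4) = z := by
        rw [show z ^ 2 / 4 = (z / 2) ^ 2 by ring, Real.sqrt_sq (by positivity)]; ring
      have hzle : z ^ 2 / 4 ≤ w := by
        rw [← hsq w hw0.le]; gcongr
      rw [← ez, hcz _ hz4] at hz0
      rcases only _ hz4 hzle hz0 with hh | hh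
      · left; rw [← hh, ez]
      · right; rw [Set.mem_singleton_iff, ← hh, ez]
    · rintro (rfl | rfl)
      · exact ⟨by have := Real.sqrt_pos.2 hv0'; positivity, hvw.le, (hcz v hv0').2 hv0⟩
      · exact ⟨by have := Real.sqrt_pos.2 hw0; positivity, le_rfl, (hcz w hw0).2 h⟩
  rw [hset, Set.encard_pair hvw.ne]
  rfl

/-! ### Enclosures at the test points (0.04495, 10.17661) and (0.044952, 10.17663) and at their
inner arguments r²w -/

theorem phi_3_outer_lo : 0.00000001858 < phi 3 10.17661 ∧ phi 3 10.17661 < 0.00000001860 := by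
  have h := abs_le.1 (phi_approx 3 (w := 10.17661) (by norm_num) 22 (by norm_num))
  norm_num [Finset.sum_range_succ, phiCoeff, Nat.factorial] at h
  constructor <;> norm_num <;> linarith

theorem sigma_3_outer_lo : 0.0465 < sigma 3 10.17661 ∧ sigma 3 10.17661 < 0.0466 := by
  have h := abs_le.1 (sigma_approx 3 (w := 10.17661) (by norm_num) 22 (by norm_num))
  norm_num [Finset.sum_range_succ, sigmaCoeff, phiCoeff, Nat.factorial,
    harmonic_succ, harmonic_zero] at h
  constructor <;> norm_num <;> linarith

theorem phi_0_outer_lo : 0.2396535976 < phi 0 10.17661 ∧ phi 0 10.17661 < 0.2396535977 := by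
  have h := abs_le.1 (phi_approx 0 (w := 10.17661) (by norm_num) 22 (by norm_num))
  norm_num [Finset.sum_range_succ, phiCoeff, Nat.factorial] at h
  constructor <;> norm_num <;> linarith

theorem sigma_0_outer_lo : -0.7384588083 < sigma 0 10.17661 ∧ sigma 0 10.17661 < -0.7384588082 := by
  have h := abs_le.1 (sigma_approx 0 (w := 10.17661) (by norm_num) 22 (by norm_num))
  norm_num [Finset.sum_range_succ, sigmaCoeff, phiCoeff, Nat.factorial,
    harmonic_succ, harmonic_zero] at h
  constructor <;> norm_num <;> linarith

theorem phi_3_inner_lo : 0.1657 < phi 3 0.020561865946525 ∧ phi 3 0.020561865946525 < 0.1659 := by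
  have h := abs_le.1 (phi_approx 3 (w := 0.020561865946525) (by norm_num) 7 (by norm_num))
  norm_num [Finset.sum_range_succ, phiCoeff, Nat.factorial] at h
  constructor <;> norm_num <;> linarith

theorem sigma_3_inner_lo : -0.1515 < sigma 3 0.020561865946525 ∧ sigma 3 0.020561865946525 < -0.1514 := by
  have h := abs_le.1 (sigma_approx 3 (w := 0.020561865946525) (by norm_num) 7 (by norm_num))
  norm_num [Finset.sum_range_succ, sigmaCoeff, phiCoeff, Nat.factorial,
    harmonic_succ, harmonic_zero] at h
  constructor <;> norm_num <;> linarith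

theorem phi_0_inner_lo : 0.9795435904 < phi 0 0.020561865946525 ∧ phi 0 0.020561865946525 < 0.9795435905 := by
  have h := abs_le.1 (phi_approx 0 (w := 0.020561865946525) (by norm_num) 7 (by norm_num))
  norm_num [Finset.sum_range_succ, phiCoeff, Nat.factorial] at h
  constructor <;> norm_num <;> linarith

theorem sigma_0_inner_lo : 0.0204037616 < sigma 0 0.020561865946525 ∧ sigma 0 0.020561865946525 < 0.0204037617 := by
  have h := abs_le.1 (sigma_approx 0 (w := 0.020561865946525) (by norm_num) 7 (by norm_num))
  norm_num [Finset.sum_range_succ, sigmaCoeff, phiCoeff, Nat.factorial,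
    harmonic_succ, harmonic_zero] at h
  constructor <;> norm_num <;> linarith

theorem phi_3_outer_hi : -0.00000003902 < phi 3 10.17663 ∧ phi 3 10.17663 < -0.00000003901 := by
  have h := abs_le.1 (phi_approx 3 (w := 10.17663) (by norm_num) 22 (by norm_num))
  norm_num [Finset.sum_range_succ, phiCoeff, Nat.factorial] at h
  constructor <;> norm_num <;> linarith

theorem sigma_3_outer_hi : 0.0465 < sigma 3 10.17663 ∧ sigma 3 10.17663 < 0.0466 := by
  have h := abs_le.1 (sigma_approx 3 (w := 10.17663) (by norm_num) 22 (by norm_num))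
  norm_num [Finset.sum_range_succ, sigmaCoeff, phiCoeff, Nat.factorial,
    harmonic_succ, harmonic_zero] at h
  constructor <;> norm_num <;> linarith

theorem phi_0_outer_hi : 0.2396547700 < phi 0 10.17663 ∧ phi 0 10.17663 < 0.2396547701 := by
  have h := abs_le.1 (phi_approx 0 (w := 10.17663) (by norm_num) 22 (by norm_num))
  norm_num [Finset.sum_range_succ, phiCoeff, Nat.factorial] at h
  constructor <;> norm_num <;> linarith

theorem sigma_0_outer_hi : -0.7384585561 < sigma 0 10.17663 ∧ sigma 0 10.17663 < -0.7384585560 := by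
  have h := abs_le.1 (sigma_approx 0 (w := 10.17663) (by norm_num) 22 (by norm_num))
  norm_num [Finset.sum_range_succ, sigmaCoeff, phiCoeff, Nat.factorial,
    harmonic_succ, harmonic_zero] at h
  constructor <;> norm_num <;> linarith

theorem phi_3_inner_hi : 0.1657 < phi 3 0.02056373615535552 ∧ phi 3 0.02056373615535552 < 0.1659 := by
  have h := abs_le.1 (phi_approx 3 (w := 0.02056373615535552) (by norm_num) 7 (by norm_num))
  norm_num [Finset.sum_range_succ, phiCoeff, Nat.factorial] at h
  constructor <;> norm_num <;> linarith

theorem sigma_3_inner_hi : -0.1515 < sigma 3 0.02056373615535552 ∧ sigma 3 0.02056373615535552 < -0.1514 := by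
  have h := abs_le.1 (sigma_approx 3 (w := 0.02056373615535552) (by norm_num) 7 (by norm_num))
  norm_num [Finset.sum_range_succ, sigmaCoeff, phiCoeff, Nat.factorial,
    harmonic_succ, harmonic_zero] at h
  constructor <;> norm_num <;> linarith

theorem phi_0_inner_hi : 0.9795417393 < phi 0 0.02056373615535552 ∧ phi 0 0.02056373615535552 < 0.9795417395 := by
  have h := abs_le.1 (phi_approx 0 (w := 0.02056373615535552) (by norm_num) 7 (by norm_num))
  norm_num [Finset.sum_range_succ, phiCoeff, Nat.factorial] at h
  constructor <;> norm_num <;> linarith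

theorem sigma_0_inner_hi : 0.0204056031 < sigma 0 0.02056373615535552 ∧ sigma 0 0.02056373615535552 < 0.0204056032 := by
  have h := abs_le.1 (sigma_approx 0 (w := 0.02056373615535552) (by norm_num) 7 (by norm_num))
  norm_num [Finset.sum_range_succ, sigmaCoeff, phiCoeff, Nat.factorial,
    harmonic_succ, harmonic_zero] at h
  constructor <;> norm_num <;> linarith

/-! ### Order three: the cross-product as a perturbation of φ_3 -/

theorem abs_sigma_three_le {w : ℝ} (hw : |w| ≤ 10.2) : |sigma 3 w| ≤ 5 := by
  have hd : BesselDecay (3 + 1) (fun k => |sigmaCoeff 3 k|) := fun k => by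
    simpa using sigmaCoeff_decay 3 k
  refine ((sigmaCoeff_decay 3).abs_powerSum_le hw).trans ?_
  have h := abs_le.1 (hd.abs_powerSum_sub_le 20 (w := 10.2) (by norm_num))
  generalize powerSum (fun k => |sigmaCoeff 3 k|) 10.2 = P at h ⊢
  norm_num [Finset.sum_range_succ, sigmaCoeff, phiCoeff, Nat.factorial, harmonic_succ,
    harmonic_zero, abs_mul, abs_of_pos] at h
  linarith

theorem abs_sigmaDeriv_three_le {w : ℝ} (hw : |w| ≤ 10.2) : |sigmaDeriv 3 w| ≤ 5 := by
  have hd : BesselDecay (2 * (3 + 1)) (fun k => |derivCoeff (sigmaCoeff 3) k|) := fun k => by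
    simpa using (sigmaCoeff_decay 3).formalDeriv k
  refine ((sigmaCoeff_decay 3).formalDeriv.abs_powerSum_le hw).trans ?_
  have h := abs_le.1 (hd.abs_powerSum_sub_le 20 (w := 10.2) (by norm_num))
  generalize powerSum (fun k => |derivCoeff (sigmaCoeff 3) k|) 10.2 = P at h ⊢
  norm_num [Finset.sum_range_succ, derivCoeff, sigmaCoeff, phiCoeff, Nat.factorial, harmonic_succ,
    harmonic_zero, abs_mul, abs_of_pos] at h
  linarith

theorem phi_three_bounds {w : ℝ} (h0 : 0 ≤ w) (h1 : w ≤ 10.2) : |phi 3 w| ≤ 1 / 6 := by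
  have hm : StrictAntiOn (phi 3) (Set.Icc 0 10.2) :=
    phi_strictAntiOn fun w hw => phi_four_pos w ⟨hw.1.le, hw.2.le⟩
  have a := hm.antitoneOn (a := 0) (b := w) ⟨le_rfl, by norm_num⟩ ⟨h0, h1⟩ h0
  have b := hm.antitoneOn (a := w) (b := 10.2) ⟨h0, h1⟩ ⟨by norm_num, le_rfl⟩ h1
  rw [phi_at_zero] at a
  norm_num [Nat.factorial] at a
  exact abs_le.2 ⟨by linarith [phi_3_at_10_2.1], a⟩

theorem phi_four_bounds {w : ℝ} (h0 : 0 ≤ w) (h1 : w ≤ 10.2) :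
    0.0028 ≤ phi 4 w ∧ phi 4 w ≤ 1 / 24 := by
  have hm : StrictAntiOn (phi 4) (Set.Icc 0 10.2) :=
    phi_strictAntiOn fun w hw => phi_five_pos w ⟨hw.1.le, hw.2.le⟩
  have a := hm.antitoneOn (a := 0) (b := w) ⟨le_rfl, by norm_num⟩ ⟨h0, h1⟩ h0
  have b := hm.antitoneOn (a := w) (b := 10.2) ⟨h0, h1⟩ ⟨by norm_num, le_rfl⟩ h1
  rw [phi_at_zero] at a
  norm_num [Nat.factorial] at a
  exact ⟨by linarith [phi_4_at_10_2.1], a⟩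

/-- The bilinear part of the cross-product of order three. -/
noncomputable def crossBilin (r w : ℝ) : ℝ :=
  -Real.log r * (phi 3 (r ^ 2 * w) * phi 3 w) + phi 3 (r ^ 2 * w) * sigma 3 w
    - phi 3 w * sigma 3 (r ^ 2 * w)

/-- `2 r^6 w^3` times `crossSol` of order three, an entire function of `w`. -/
noncomputable def crossThree (r w : ℝ) : ℝ :=
  phi 3 w * (2 + r ^ 2 * w + (r ^ 2 * w) ^ 2 / 2) + r ^ 6 * (2 * w ^ 3 * crossBilin r w -
    phi 3 (r ^ 2 * w) * (2 + w + w ^ 2 / 2))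

theorem crossThree_eq {r w : ℝ} (hr : 0 < r) (hw : 0 < w) :
    crossThree r w = 2 * r ^ 6 * w ^ 3 * crossSol 3 (r ^ 2 * w) w := by
  have hl : Real.log (r ^ 2 * w) = 2 * Real.log r + Real.log w := by
    rw [Real.log_mul (by positivity) hw.ne', Real.log_pow]; push_cast; ring
  rw [crossThree, crossBilin, crossSol, psi, psi, hl, polarPart_three, polarPart_three]
  generalize phi 3 (r ^ 2 * w) = A
  generalize sigma 3 (r ^ 2 * w) = B
  field_simp
  ring

theorem neg_log_bounds {r : ℝ} (hr : 0.04 ≤ r) (hr' : r ≤ 0.045) :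
    0 ≤ -Real.log r ∧ -Real.log r ≤ 3.5 := by
  have h1 := Real.log_nonpos (by linarith) (by linarith : r ≤ 1)
  have h2 : Real.log ((2 : ℝ) ^ 5)⁻¹ ≤ Real.log r := Real.log_le_log (by norm_num) (by
    norm_num; linarith)
  rw [Real.log_inv, Real.log_pow] at h2
  have := Real.log_two_lt_d9
  push_cast at h2
  exact ⟨by linarith, by linarith⟩

theorem abs_mul_le_of {a b A B : ℝ} (ha : |a| ≤ A) (hb : |b| ≤ B) : |a * b| ≤ A * B := by
  rw [abs_mul]
  exact mul_le_mul ha hb (abs_nonneg _) ((abs_nonneg _).trans ha)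

theorem inner_bounds {r w : ℝ} (hr : 0.04 ≤ r) (hr' : r ≤ 0.045) (h0 : 0 ≤ w) (h1 : w ≤ 10.2) :
    0 ≤ r ^ 2 * w ∧ r ^ 2 * w ≤ 0.03 := by
  have : r ^ 2 ≤ 0.0025 := by nlinarith
  exact ⟨by positivity, by nlinarith⟩

/-- The constants come from 5/6 ≤ 0.84 and 3.5/6 + 5 ≤ 5.6. -/
theorem abs_crossBilin_le {r w P : ℝ} (hr : 0.04 ≤ r) (hr' : r ≤ 0.045) (h0 : 0 ≤ w)
    (h1 : w ≤ 10.2) (hP : |phi 3 w| ≤ P) : |crossBilin r w| ≤ 0.84 + 5.6 * P := by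
  obtain ⟨m0, m1⟩ := inner_bounds hr hr' h0 h1
  have hm := phi_three_bounds m0 (by linarith)
  have hL : |-Real.log r| ≤ 3.5 := by
    obtain ⟨a, b⟩ := neg_log_bounds hr hr'
    rwa [abs_of_nonneg a]
  have s := abs_sigma_three_le (w := w) (by rwa [abs_of_nonneg h0])
  have sm := abs_sigma_three_le (w := r ^ 2 * w) (by rw [abs_of_nonneg m0]; linarith)
  have a1 := abs_le.1 (abs_mul_le_of hL (abs_mul_le_of hm hP))
  have a2 := abs_le.1 (abs_mul_le_of hm s)
  have a3 := abs_le.1 (abs_mul_le_of hP sm)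
  rw [crossBilin, abs_le]
  constructor <;> linarith [(abs_nonneg _).trans hP]

theorem pow_six_le {r : ℝ} (hr : 0.04 ≤ r) (hr' : r ≤ 0.045) : r ^ 6 ≤ 8.4e-9 := by
  calc r ^ 6 ≤ 0.045 ^ 6 := by gcongr
    _ ≤ _ := by norm_num

/-- The term -φ_4(w)(2 + …) is at most -0.0056. The φ_3 term carries r² and stays below 0.00045;
everything else carries r⁶ ≤ 8.4e-9 against a bracket bounded by 10000. -/
theorem crossThree_strictAntiOn {r : ℝ} (hr : 0.04 ≤ r) (hr' : r ≤ 0.045) :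
    StrictAntiOn (crossThree r) (Set.Icc 0 10.2) := by
  have hd : ∀ w, HasDerivAt (crossThree r)
      (-phi 4 w * (2 + r ^ 2 * w + (r ^ 2 * w) ^ 2 / 2) + phi 3 w * (r ^ 2 * (1 + r ^ 2 * w)) +
      r ^ 6 * (6 * w ^ 2 * crossBilin r w + 2 * w ^ 3 *
        (-Real.log r * (-(r ^ 2 * phi 4 (r ^ 2 * w)) * phi 3 w - phi 3 (r ^ 2 * w) * phi 4 w)
        + (-(r ^ 2 * phi 4 (r ^ 2 * w)) * sigma 3 w + phi 3 (r ^ 2 * w) * sigmaDeriv 3 w)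
        + (phi 4 w * sigma 3 (r ^ 2 * w) - phi 3 w * (r ^ 2 * sigmaDeriv 3 (r ^ 2 * w))))
        + r ^ 2 * phi 4 (r ^ 2 * w) * (2 + w + w ^ 2 / 2) - phi 3 (r ^ 2 * w) * (1 + w))) w := by
    intro w
    have hm : HasDerivAt (fun w => r ^ 2 * w) (r ^ 2) w := by
      simpa using (hasDerivAt_id w).const_mul (r ^ 2)
    have hf := hasDerivAt_phi 3 w
    have hfm : HasDerivAt (fun w => phi 3 (r ^ 2 * w)) (-phi 4 (r ^ 2 * w) * r ^ 2) w :=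
      (hasDerivAt_phi 3 (r ^ 2 * w)).comp w hm
    have hs := hasDerivAt_sigma 3 w
    have hsm : HasDerivAt (fun w => sigma 3 (r ^ 2 * w)) (sigmaDeriv 3 (r ^ 2 * w) * r ^ 2) w :=
      (hasDerivAt_sigma 3 (r ^ 2 * w)).comp w hm
    have hB : HasDerivAt (crossBilin r) _ w :=
      (((hfm.mul hf).const_mul (-Real.log r)).add (hfm.mul hs)).sub (hf.mul hsm)
    have hp : HasDerivAt (fun w => 2 + r ^ 2 * w + (r ^ 2 * w) ^ 2 / 2) _ w :=
      (hm.const_add 2).add ((hm.pow 2).div_const 2)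
    have hq : HasDerivAt (fun w : ℝ => 2 + w + w ^ 2 / 2) _ w :=
      ((hasDerivAt_id w).const_add 2).add ((hasDerivAt_pow 2 w).div_const 2)
    have hw3 := (hasDerivAt_pow 3 w).const_mul 2
    have hD : HasDerivAt (crossThree r) _ w :=
      (hf.mul hp).add (((hw3.mul hB).sub (hfm.mul hq)).const_mul (r ^ 6))
    refine hD.congr_deriv ?_
    norm_num
    ring
  refine strictAntiOn_of_deriv_neg (convex_Icc _ _)
    (fun w _ => (hd w).continuousAt.continuousWithinAt) fun w hw => ?_
  rw [interior_Icc] at hw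
  obtain ⟨h0, h1⟩ := hw
  rw [(hd w).deriv]
  obtain ⟨m0, m1⟩ := inner_bounds hr hr' h0.le h1.le
  have hw' : |w| ≤ 10.2 := by rw [abs_of_pos h0]; exact h1.le
  have hm' : |r ^ 2 * w| ≤ 10.2 := by rw [abs_of_nonneg m0]; linarith
  have f3 := phi_three_bounds h0.le h1.le
  have f3m := phi_three_bounds m0 (by linarith)
  obtain ⟨f4l, f4u⟩ := phi_four_bounds h0.le h1.le
  obtain ⟨f4ml, f4mu⟩ := phi_four_bounds m0 (by linarith)
  have f4 : |phi 4 w| ≤ 1 / 24 := abs_le.2 ⟨by linarith, f4u⟩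
  have f4m : |phi 4 (r ^ 2 * w)| ≤ 1 / 24 := abs_le.2 ⟨by linarith, f4mu⟩
  have s := abs_sigma_three_le hw'
  have sm := abs_sigma_three_le hm'
  have ds := abs_sigmaDeriv_three_le hw'
  have dsm := abs_sigmaDeriv_three_le hm'
  have hB := abs_crossBilin_le hr hr' h0.le h1.le f3
  have hr2 : |r ^ 2| ≤ 0.0025 := by rw [abs_of_nonneg (sq_nonneg r)]; nlinarith
  have hL : |-Real.log r| ≤ 3.5 := by
    obtain ⟨a, b⟩ := neg_log_bounds hr hr'
    rwa [abs_of_nonneg a]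
  have w2 : |6 * w ^ 2| ≤ 625 := by
    rw [abs_of_nonneg (by positivity)]; nlinarith
  have w3 : |2 * w ^ 3| ≤ 2200 := by
    rw [abs_of_nonneg (by positivity)]
    have : w ^ 3 ≤ 10.2 ^ 3 := by gcongr
    norm_num at this ⊢; linarith
  have q1 : |2 + w + w ^ 2 / 2| ≤ 70 := by
    rw [abs_of_nonneg (by positivity)]; nlinarith
  have q2 : |1 + w| ≤ 12 := by rw [abs_of_nonneg (by positivity)]; linarith
  set B' := -Real.log r * (-(r ^ 2 * phi 4 (r ^ 2 * w)) * phi 3 w - phi 3 (r ^ 2 * w) * phi 4 w)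
        + (-(r ^ 2 * phi 4 (r ^ 2 * w)) * sigma 3 w + phi 3 (r ^ 2 * w) * sigmaDeriv 3 w)
        + (phi 4 w * sigma 3 (r ^ 2 * w) - phi 3 w * (r ^ 2 * sigmaDeriv 3 (r ^ 2 * w))) with hB'
  have k0 := abs_mul_le_of hr2 f4m
  have k0' : |-(r ^ 2 * phi 4 (r ^ 2 * w))| ≤ 0.0025 * (1 / 24) := by rwa [abs_neg]
  have k1 : |-(r ^ 2 * phi 4 (r ^ 2 * w)) * phi 3 w - phi 3 (r ^ 2 * w) * phi 4 w| ≤ 0.01 := by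
    have a := abs_le.1 (abs_mul_le_of k0' f3)
    have b := abs_le.1 (abs_mul_le_of f3m f4)
    rw [abs_le]; constructor <;> linarith
  have hB'b : |B'| ≤ 2 := by
    have a := abs_le.1 (abs_mul_le_of hL k1)
    have b := abs_le.1 (abs_mul_le_of k0' s)
    have c := abs_le.1 (abs_mul_le_of f3m ds)
    have d := abs_le.1 (abs_mul_le_of f4 sm)
    have e := abs_le.1 (abs_mul_le_of f3 (abs_mul_le_of hr2 dsm))
    rw [hB', abs_le]; constructor <;> linarith
  set E := 6 * w ^ 2 * crossBilin r w + 2 * w ^ 3 * B'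
        + r ^ 2 * phi 4 (r ^ 2 * w) * (2 + w + w ^ 2 / 2) - phi 3 (r ^ 2 * w) * (1 + w) with hE
  have hEb : |E| ≤ 10000 := by
    have a := abs_le.1 (abs_mul_le_of w2 hB)
    have b := abs_le.1 (abs_mul_le_of w3 hB'b)
    have c := abs_le.1 (abs_mul_le_of k0 q1)
    have d := abs_le.1 (abs_mul_le_of f3m q2)
    rw [hE, abs_le]; constructor <;> linarith
  have r6 : |r ^ 6| ≤ 8.4e-9 := by
    rw [abs_of_nonneg (by positivity)]; exact pow_six_le hr hr'
  have t1 := (abs_le.1 (abs_mul_le_of r6 hEb)).2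
  have q3 : |1 + r ^ 2 * w| ≤ 1.03 := by rw [abs_of_nonneg (by positivity)]; linarith
  have t2 := (abs_le.1 (abs_mul_le_of f3 (abs_mul_le_of hr2 q3))).2
  have t3 : 0.0028 * 2 ≤ phi 4 w * (2 + r ^ 2 * w + (r ^ 2 * w) ^ 2 / 2) := by
    gcongr
    have : 0 ≤ (r ^ 2 * w) ^ 2 / 2 := by positivity
    linarith
  norm_num at t1 t2 t3 ⊢
  linarith

/-- The bound keeps `P` because the useful points lie near the zero of φ_3, where |φ_3| is far below
1/6. -/
theorem abs_crossThree_sub_le {r w P : ℝ} (hr : 0.04 ≤ r) (hr' : r ≤ 0.045) (h0 : 0 ≤ w)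
    (h1 : w ≤ 10.2) (hP : |phi 3 w| ≤ P) :
    |crossThree r w - phi 3 w * (2 + r ^ 2 * w + (r ^ 2 * w) ^ 2 / 2)| ≤
      8.4e-9 * (1800 + 12000 * P) := by
  obtain ⟨m0, m1⟩ := inner_bounds hr hr' h0 h1
  have f3m := phi_three_bounds m0 (by linarith)
  have hB := abs_crossBilin_le hr hr' h0 h1 hP
  have w3 : |2 * w ^ 3| ≤ 2123 := by
    rw [abs_of_nonneg (by positivity)]
    have : w ^ 3 ≤ 10.2 ^ 3 := by gcongr
    norm_num at this ⊢; linarith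
  have q1 : |2 + w + w ^ 2 / 2| ≤ 70 := by
    rw [abs_of_nonneg (by positivity)]; nlinarith
  have r6 : |r ^ 6| ≤ 8.4e-9 := by
    rw [abs_of_nonneg (by positivity)]; exact pow_six_le hr hr'
  have a := abs_le.1 (abs_mul_le_of w3 hB)
  have b := abs_le.1 (abs_mul_le_of f3m q1)
  rw [crossThree, add_sub_cancel_left]
  refine abs_mul_le_of r6 (abs_le.2 ⟨?_, ?_⟩) <;> linarith [(abs_nonneg _).trans hP]

theorem crossThree_signs {r : ℝ} (hr : 0.04 ≤ r) (hr' : r ≤ 0.045) :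
    0 < crossThree r 10.17 ∧ crossThree r 10.2 < 0 := by
  constructor
  · have p := phi_3_at_10_17
    have h := (abs_le.1 (abs_crossThree_sub_le (w := 10.17) (P := 0.00002) hr hr' (by norm_num)
      (by norm_num) (abs_le.2 ⟨by linarith, by linarith⟩))).1
    obtain ⟨m0, -⟩ := inner_bounds (w := 10.17) hr hr' (by norm_num) (by norm_num)
    have k : 0.000018 * 2 ≤ phi 3 10.17 * (2 + r ^ 2 * 10.17 + (r ^ 2 * 10.17) ^ 2 / 2) := by
      refine mul_le_mul p.1.le ?_ (by norm_num) (by linarith [p.1])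
      have : 0 ≤ (r ^ 2 * 10.17) ^ 2 / 2 := by positivity
      linarith
    norm_num at h k ⊢
    linarith
  · have p := phi_3_at_10_2
    have h := (abs_le.1 (abs_crossThree_sub_le (w := 10.2) (P := 0.00007) hr hr' (by norm_num)
      (by norm_num) (abs_le.2 ⟨by linarith, by linarith⟩))).2
    obtain ⟨m0, -⟩ := inner_bounds (w := 10.2) hr hr' (by norm_num) (by norm_num)
    have k : 0.00006 * 2 ≤ -phi 3 10.2 * (2 + r ^ 2 * 10.2 + (r ^ 2 * 10.2) ^ 2 / 2) := by
      refine mul_le_mul (by linarith [p.2]) ?_ (by norm_num) (by linarith [p.2])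
      have : 0 ≤ (r ^ 2 * 10.2) ^ 2 / 2 := by positivity
      linarith
    norm_num at h k ⊢
    linarith

/-- Strict monotonicity down to w = 0 makes `crossThree` injective, so no smaller positive zero
exists. -/
theorem isNthPosZero_besselCross_three {r w : ℝ} (hr : 0.04 ≤ r) (hr' : r ≤ 0.045) (hw : 0 < w)
    (hw' : w ≤ 10.2) (h : crossThree r w = 0) : IsNthPosZero (besselCross 3 r) 1 (2 * √w) := by
  have hr0 : 0 < r := by linarith
  have hsq : ∀ x : ℝ, 0 ≤ x → (2 * √x) ^ 2 / 4 = x := fun x hx => by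
    rw [mul_pow, Real.sq_sqrt hx]; ring
  have hcz : ∀ z, 0 < z → (besselCross 3 r z = 0 ↔ crossThree r (z ^ 2 / 4) = 0) :=
    fun z hz => by
      rw [besselCross_eq_zero_iff 3 hr0 hz, crossThree_eq hr0 (by positivity), mul_eq_zero,
        or_iff_right (by positivity)]
  have ha : 0 < 2 * √w := by have := Real.sqrt_pos.2 hw; positivity
  have hza : besselCross 3 r (2 * √w) = 0 := (hcz _ ha).2 (by rwa [hsq w hw.le])
  refine ⟨ha, hza, ?_⟩
  have hset : {z : ℝ | 0 < z ∧ z ≤ 2 * √w ∧ besselCross 3 r z = 0} = {2 * √w} := by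
    ext z
    constructor
    · rintro ⟨hz, hzw, hz0⟩
      have hzle : z ^ 2 / 4 ≤ w := by
        rw [← hsq w hw.le]; gcongr
      have e := (crossThree_strictAntiOn hr hr').injOn ⟨by positivity, hzle.trans hw'⟩
        ⟨hw.le, hw'⟩ (((hcz z hz).1 hz0).trans h.symm)
      rw [Set.mem_singleton_iff, ← e, show z ^ 2 / 4 = (z / 2) ^ 2 by ring,
        Real.sqrt_sq (by positivity)]
      ring
    · rintro rfl
      exact ⟨ha, le_rfl, hza⟩
  rw [hset, Set.encard_singleton]
  rfl

/-! ### Signs at the two test points -/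

theorem inner_lo_eq : (0.04495 : ℝ) ^ 2 * 10.17661 = 0.020561865946525 := by norm_num

theorem inner_hi_eq : (0.044952 : ℝ) ^ 2 * 10.17663 = 0.02056373615535552 := by norm_num

/-- The square of the argument is close to 2⁻⁹, so log 2 and a short Taylor polynomial of log(1 - x)
suffice. -/
theorem log_lo : 3.10220451 < -Real.log 0.04495 ∧ -Real.log 0.04495 < 3.10220453 := by
  have h : (0.04495 : ℝ) ^ 2 = (1 - (-0.03449728)) * ((2 : ℝ) ^ 9)⁻¹ := by norm_num
  have hl := congrArg Real.log h
  rw [Real.log_pow, Real.log_mul (by norm_num) (by norm_num), Real.log_inv, Real.log_pow] at hl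
  have ha := abs_le.1 (Real.abs_log_sub_add_sum_range_le (x := -0.03449728)
    (by rw [abs_lt]; constructor <;> norm_num) 6)
  norm_num [Finset.sum_range_succ, abs_of_neg] at ha hl
  have h1 := Real.log_two_gt_d9
  have h2 := Real.log_two_lt_d9
  norm_num at h1 h2 ⊢
  constructor <;> linarith [ha.1, ha.2]

theorem log_hi : 3.10216001 < -Real.log 0.044952 ∧ -Real.log 0.044952 < 3.10216003 := by
  have h : (0.044952 : ℝ) ^ 2 = (1 - (-0.034589339648)) * ((2 : ℝ) ^ 9)⁻¹ := by norm_num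
  have hl := congrArg Real.log h
  rw [Real.log_pow, Real.log_mul (by norm_num) (by norm_num), Real.log_inv, Real.log_pow] at hl
  have ha := abs_le.1 (Real.abs_log_sub_add_sum_range_le (x := -0.034589339648)
    (by rw [abs_lt]; constructor <;> norm_num) 6)
  norm_num [Finset.sum_range_succ, abs_of_neg] at ha hl
  have h1 := Real.log_two_gt_d9
  have h2 := Real.log_two_lt_d9
  norm_num at h1 h2 ⊢
  constructor <;> linarith [ha.1, ha.2]

/-- The three terms nearly cancel, leaving a margin of about 1.5e-5; hence the precision of the
order-zero enclosures. -/
theorem crossQuot_lo_pos : 0 < crossQuot 0.04495 10.17661 := by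
  obtain ⟨a1, a2⟩ := phi_0_outer_lo
  obtain ⟨b1, b2⟩ := sigma_0_outer_lo
  obtain ⟨c1, c2⟩ := phi_0_inner_lo
  obtain ⟨d1, d2⟩ := sigma_0_inner_lo
  have h1 : -3.0813592 < sigma 0 10.17661 / phi 0 10.17661 := by
    rw [lt_div_iff₀ (by linarith)]; linarith
  have h2 : sigma 0 0.020561865946525 / phi 0 0.020561865946525 < 0.0208300 := by
    rw [div_lt_iff₀ (by linarith)]; linarith
  rw [crossQuot, inner_lo_eq]
  linarith [log_lo.1]

theorem crossQuot_hi_neg : crossQuot 0.044952 10.17663 < 0 := by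
  obtain ⟨a1, a2⟩ := phi_0_outer_hi
  obtain ⟨b1, b2⟩ := sigma_0_outer_hi
  obtain ⟨c1, c2⟩ := phi_0_inner_hi
  obtain ⟨d1, d2⟩ := sigma_0_inner_hi
  have h1 : sigma 0 10.17663 / phi 0 10.17663 < -3.0813430 := by
    rw [div_lt_iff₀ (by linarith)]; linarith
  have h2 : 0.0208317 < sigma 0 0.02056373615535552 / phi 0 0.02056373615535552 := by
    rw [lt_div_iff₀ (by linarith)]; linarith
  rw [crossQuot, inner_hi_eq]
  linarith [log_hi.2]

/-- Here φ_3 is still positive and the r⁶ bracket is positive too, so crude values of the other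
factors are enough. -/
theorem crossThree_lo_pos : 0 < crossThree 0.04495 10.17661 := by
  obtain ⟨a1, a2⟩ := phi_3_outer_lo
  obtain ⟨b1, b2⟩ := sigma_3_outer_lo
  obtain ⟨c1, c2⟩ := phi_3_inner_lo
  obtain ⟨d1, d2⟩ := sigma_3_inner_lo
  have hL := log_lo.1
  rw [crossThree, crossBilin, inner_lo_eq]
  set x := phi 3 10.17661
  set s := sigma 3 10.17661
  set y := phi 3 0.020561865946525
  set t := sigma 3 0.020561865946525
  have k1 : 0 ≤ -Real.log 0.04495 * (y * x) :=
    mul_nonneg (by linarith) (mul_nonneg (by linarith) (by linarith))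
  have k2 : 0.1657 * 0.0465 ≤ y * s := mul_le_mul c1.le b1.le (by norm_num) (by linarith)
  have k3 : 0 ≤ x * -t := mul_nonneg (by linarith) (by linarith)
  have k4 : 0 < 2 * (10.17661 : ℝ) ^ 3 * (-Real.log 0.04495 * (y * x) + y * s - x * t) -
      y * (2 + 10.17661 + 10.17661 ^ 2 / 2) := by
    norm_num at k2 c2 ⊢
    linarith
  have k5 : 0 < x * (2 + 0.020561865946525 + 0.020561865946525 ^ 2 / 2) :=
    mul_pos (by linarith) (by norm_num)
  have k6 := mul_pos (show (0 : ℝ) < 0.04495 ^ 6 by norm_num) k4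
  linarith

/-- The positive r⁶ bracket contributes about 5e-8 at most, less than the 7.8e-8 coming from 2|φ_3|.
-/
theorem crossThree_hi_neg : crossThree 0.044952 10.17663 < 0 := by
  obtain ⟨a1, a2⟩ := phi_3_outer_hi
  obtain ⟨b1, b2⟩ := sigma_3_outer_hi
  obtain ⟨c1, c2⟩ := phi_3_inner_hi
  obtain ⟨d1, d2⟩ := sigma_3_inner_hi
  have hL := log_hi.1
  rw [crossThree, crossBilin, inner_hi_eq]
  set x := phi 3 10.17663
  set s := sigma 3 10.17663
  set y := phi 3 0.02056373615535552
  set t := sigma 3 0.02056373615535552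
  have k1 : 0 ≤ -Real.log 0.044952 * (y * -x) :=
    mul_nonneg (by linarith) (mul_nonneg (by linarith) (by linarith))
  have k2 : y * s ≤ 0.1659 * 0.0466 :=
    mul_le_mul c2.le b2.le (by linarith) (by norm_num)
  have k3 : 0 ≤ -x * -t := mul_nonneg (by linarith) (by linarith)
  have k4 : 2 * (10.17663 : ℝ) ^ 3 * (-Real.log 0.044952 * (y * x) + y * s - x * t) -
      y * (2 + 10.17663 + 10.17663 ^ 2 / 2) ≤ 6 := by
    norm_num at k2 c1 ⊢
    linarith
  have k5 := mul_le_mul_of_nonneg_left k4 (show (0 : ℝ) ≤ 0.044952 ^ 6 by norm_num)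
  norm_num at a2 k5 ⊢
  linarith

/-! ### The common zero -/

theorem exists_crossThree_zero {r : ℝ} (hr : 0.04 ≤ r) (hr' : r ≤ 0.045) :
    ∃ w ∈ Set.Ioo (10.17 : ℝ) 10.2, crossThree r w = 0 := by
  obtain ⟨h1, h2⟩ := crossThree_signs hr hr'
  have hc : Continuous (crossThree r) := by
    have := phi_continuous 3
    have := sigma_continuous 3
    unfold crossThree crossBilin
    fun_prop
  exact intermediate_value_Ioo' (by norm_num) hc.continuousOn ⟨h2, h1⟩

theorem continuousAt_crossThree_left {r : ℝ} (hr : 0 < r) (w : ℝ) :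
    ContinuousAt (fun r => crossThree r w) r := by
  have := phi_continuous 3
  have := sigma_continuous 3
  have hl := Real.continuousAt_log hr.ne'
  have h1 : Continuous fun r : ℝ => phi 3 (r ^ 2 * w) := by fun_prop
  have h2 : Continuous fun r : ℝ => sigma 3 (r ^ 2 * w) := by fun_prop
  have h1' := h1.continuousAt (x := r)
  have h2' := h2.continuousAt (x := r)
  unfold crossThree crossBilin
  fun_prop

/-- The curves of zeros of the two cross-products meet. -/
theorem exists_common_zero : ∃ r w : ℝ, 0.04495 < r ∧ r < 0.044952 ∧ 10.17 < w ∧ w < 10.2 ∧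
    crossThree r w = 0 ∧ crossSol 0 (r ^ 2 * w) w = 0 := by
  choose! W hW using fun (r : ℝ) (h : 0.04 ≤ r ∧ r ≤ 0.045) => exists_crossThree_zero h.1 h.2
  have hI : ∀ r ∈ Set.Icc (0.04495 : ℝ) 0.044952, 0.04 ≤ r ∧ r ≤ 0.045 := fun r hr =>
    ⟨by linarith [hr.1], by linarith [hr.2]⟩
  have hmem : ∀ w ∈ Set.Ioo (10.17 : ℝ) 10.2, w ∈ Set.Icc (0 : ℝ) 10.2 := fun w hw =>
    ⟨by linarith [hw.1], hw.2.le⟩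
  have lt_of_pos : ∀ r w, 0.04 ≤ r ∧ r ≤ 0.045 → w ∈ Set.Ioo (10.17 : ℝ) 10.2 →
      0 < crossThree r w → w < W r := fun r w hr hw h => by
    obtain ⟨h1, h2⟩ := hW r hr
    by_contra hn
    have := (crossThree_strictAntiOn hr.1 hr.2).antitoneOn (hmem _ h1) (hmem _ hw) (not_lt.1 hn)
    linarith
  have lt_of_neg : ∀ r w, 0.04 ≤ r ∧ r ≤ 0.045 → w ∈ Set.Ioo (10.17 : ℝ) 10.2 →
      crossThree r w < 0 → W r < w := fun r w hr hw h => by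
    obtain ⟨h1, h2⟩ := hW r hr
    by_contra hn
    have := (crossThree_strictAntiOn hr.1 hr.2).antitoneOn (hmem _ hw) (hmem _ h1) (not_lt.1 hn)
    linarith
  -- For fixed w near W(r), the sign of `crossThree` persists for nearby r and, by monotonicity in
  -- w, confines W there.
  have hcont : ContinuousOn W (Set.Icc 0.04495 0.044952) := by
    intro r hr
    have hr' := hI r hr
    obtain ⟨h1, h2⟩ := hW r hr'
    have anti := crossThree_strictAntiOn hr'.1 hr'.2
    refine tendsto_order.2 ⟨fun a ha => ?_, fun b hb => ?_⟩
    · obtain ⟨a', ha1, ha2⟩ := exists_between (max_lt ha h1.1)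
      have ham : a' ∈ Set.Ioo (10.17 : ℝ) 10.2 := ⟨(le_max_right _ _).trans_lt ha1, ha2.trans h1.2⟩
      have hp : 0 < crossThree r a' := by
        rw [← h2]; exact anti (hmem _ ham) (hmem _ h1) ha2
      have ev := (continuousAt_crossThree_left (by linarith [hr'.1]) a').eventually
        (lt_mem_nhds hp)
      filter_upwards [nhdsWithin_le_nhds ev, self_mem_nhdsWithin] with x hx hxI
      exact ((le_max_left _ _).trans_lt ha1).trans (lt_of_pos x a' (hI x hxI) ham hx)
    · obtain ⟨b', hb1, hb2⟩ := exists_between (lt_min hb h1.2)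
      have hbm : b' ∈ Set.Ioo (10.17 : ℝ) 10.2 := ⟨h1.1.trans hb1, hb2.trans_le (min_le_right _ _)⟩
      have hp : crossThree r b' < 0 := by
        rw [← h2]; exact anti (hmem _ h1) (hmem _ hbm) hb1
      have ev := (continuousAt_crossThree_left (by linarith [hr'.1]) b').eventually
        (gt_mem_nhds hp)
      filter_upwards [nhdsWithin_le_nhds ev, self_mem_nhdsWithin] with x hx hxI
      exact (lt_of_neg x b' (hI x hxI) hbm hx).trans (hb2.trans_le (min_le_left _ _))
  obtain ⟨w₁, w₂, h10, h13, h26, h21, e1, e2, p1, p2, p3⟩ := exists_phi_zero_zeros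
  have hphi : ∀ w ∈ Set.Ioo (10.17 : ℝ) 10.2, phi 0 w ≠ 0 := fun w hw =>
    (p3 w (by linarith [hw.1]) hw.2.le).ne'
  have hinner : ∀ r ∈ Set.Icc (0.04495 : ℝ) 0.044952, phi 0 (r ^ 2 * W r) ≠ 0 := fun r hr => by
    obtain ⟨h1, h2⟩ := (hW r (hI r hr)).1
    obtain ⟨b1, b2⟩ := inner_bounds (hI r hr).1 (hI r hr).2 (by linarith) h2.le
    exact (phi_zero_pos_of_small b1 b2).ne'
  have hQ : ContinuousOn (fun r => crossQuot r (W r)) (Set.Icc 0.04495 0.044952) := by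
    have c1 : ContinuousOn (fun r : ℝ => r ^ 2 * W r) (Set.Icc 0.04495 0.044952) :=
      (continuousOn_id.pow 2).mul hcont
    have c2 := (phi_continuous 0).comp_continuousOn c1
    have c3 := (sigma_continuous 0).comp_continuousOn c1
    have c4 := (phi_continuous 0).comp_continuousOn hcont
    have c5 := (sigma_continuous 0).comp_continuousOn hcont
    have c6 : ContinuousOn Real.log (Set.Icc 0.04495 0.044952) :=
      Real.continuousOn_log.mono fun r hr => by
        have : r ≠ 0 := by have := hr.1; norm_num at this; intro h; rw [h] at this; norm_num at this
        simpa using this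
    exact (c6.neg.add (c5.div c4 fun r hr => hphi _ (hW r (hI r hr)).1)).sub (c3.div c2 hinner)
  have mono : ∀ r ∈ Set.Icc (0.04495 : ℝ) 0.044952,
      StrictMonoOn (crossQuot r) (Set.Ioo 10.17 10.2) := fun r hr =>
    crossQuot_strictMonoOn (by linarith [(hI r hr).1]) (by linarith [(hI r hr).2])
      (convex_Ioo _ _) (fun w hw => ⟨by linarith [hw.1], hw.2.le⟩) hphi
  have hl : (0.04495 : ℝ) ∈ Set.Icc (0.04495 : ℝ) 0.044952 := ⟨le_rfl, by norm_num⟩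
  have hh : (0.044952 : ℝ) ∈ Set.Icc (0.04495 : ℝ) 0.044952 := ⟨by norm_num, le_rfl⟩
  have ml : (10.17661 : ℝ) ∈ Set.Ioo (10.17 : ℝ) 10.2 := by constructor <;> norm_num
  have mh : (10.17663 : ℝ) ∈ Set.Ioo (10.17 : ℝ) 10.2 := by constructor <;> norm_num
  -- The sign of `crossThree` places W above 10.17661 at the left end and below 10.17663 at the
  -- right end; monotonicity of `crossQuot` in w carries the computed signs over to W.
  have q1 : 0 < crossQuot 0.04495 (W 0.04495) := crossQuot_lo_pos.trans
    (mono _ hl ml (hW _ (hI _ hl)).1 (lt_of_pos _ _ (hI _ hl) ml crossThree_lo_pos))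
  have q2 : crossQuot 0.044952 (W 0.044952) < 0 := lt_trans
    (mono _ hh (hW _ (hI _ hh)).1 mh (lt_of_neg _ _ (hI _ hh) mh crossThree_hi_neg))
    crossQuot_hi_neg
  obtain ⟨r, hr, hr0⟩ := intermediate_value_Ioo' (by norm_num) hQ ⟨q2, q1⟩
  have hrI := Set.Ioo_subset_Icc_self hr
  obtain ⟨hw, hz⟩ := hW r (hI r hrI)
  refine ⟨r, W r, hr.1, hr.2, hw.1, hw.2, hz, ?_⟩
  simp only at hr0
  rw [crossSol_eq_crossQuot (by linarith [(hI r hrI).1]) (by linarith [hw.1]) (hphi _ hw)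
    (hinner r hrI), hr0, mul_zero]

/-! ### Nontriviality of the radial factors at v = 1, and the conclusion -/

/-- The point 1 lies before the first zero of φ_0, where the quotient is positive. Writing m = r²·1
with r = √m makes `crossQuot` applicable. -/
theorem crossSol_zero_one_pos {m : ℝ} (h0 : 0 < m) (h1 : m ≤ 0.03) : 0 < crossSol 0 m 1 := by
  obtain ⟨w₁, -, h10, h13, -, -, e1, -, p1, -⟩ := exists_phi_zero_zeros
  have hp1 := phi_0_at_1
  have hw1 : 1 < w₁ := by
    by_contra hn
    have := phi_zero_strictAntiOn.antitoneOn (a := w₁) (b := 1) ⟨h10.le, h13.le⟩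
      ⟨by norm_num, by norm_num⟩ (not_lt.1 hn)
    linarith
  have hmono := (sigma_div_phi_strictMonoOn (by linarith) p1) (a := m) (b := 1)
    ⟨h0.le, by linarith⟩ ⟨by norm_num, hw1⟩ (by linarith)
  have hs : √m ^ 2 * 1 = m := by rw [mul_one, Real.sq_sqrt h0.le]
  have hsm : 0 < √m := Real.sqrt_pos.2 h0
  have hlog : Real.log √m < 0 := Real.log_neg hsm (by rw [Real.sqrt_lt' one_pos]; linarith)
  have hm := phi_zero_pos_of_small h0.le h1
  have e := crossSol_eq_crossQuot hsm one_pos (show phi 0 1 ≠ 0 by linarith) (by rw [hs]; exact hm.ne')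
  rw [crossQuot, hs] at e
  rw [e]
  simp only at hmono
  exact mul_pos (mul_pos hm (by linarith)) (by linarith)

/-- The polar part of ψ_3 at m is at least 1000, so -φ_3(1) ψ_3(m) dominates. -/
theorem crossSol_three_one_pos {m : ℝ} (h0 : 0 < m) (h1 : m ≤ 0.03) : 0 < crossSol 3 m 1 := by
  have f := abs_le.1 (phi_three_bounds h0.le (by linarith))
  have fm := phi_three_pos m ⟨h0.le, by linarith⟩
  have f1 := phi_3_at_1
  have s1 := abs_le.1 (abs_sigma_three_le (w := 1) (by norm_num))
  have sm := abs_le.1 (abs_sigma_three_le (w := m) (by rw [abs_of_pos h0]; linarith))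
  have hlog := Real.log_nonpos h0.le (by linarith)
  have hinv : 1000 ≤ (2 + m + m ^ 2 / 2) / m ^ 3 := by
    rw [le_div_iff₀ (by positivity)]
    have : m ^ 3 ≤ 0.03 ^ 3 := by gcongr
    have : 0 ≤ m ^ 2 / 2 := by positivity
    norm_num at *
    linarith
  have k1 : -7 ≤ psi 3 1 := by
    rw [psi, polarPart_three, Real.log_one]
    norm_num
    linarith
  have k2 : psi 3 m ≤ -400 := by
    rw [psi, polarPart_three]
    have := mul_nonpos_of_nonpos_of_nonneg (show Real.log m / 2 ≤ 0 by linarith) fm.le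
    linarith
  have k3 : phi 3 m * -7 ≤ phi 3 m * psi 3 1 := mul_le_mul_of_nonneg_left k1 fm.le
  have k4 : 0.128 * 400 ≤ phi 3 1 * -psi 3 m :=
    mul_le_mul f1.1.le (by linarith) (by norm_num) (by linarith)
  rw [crossSol]
  linarith

theorem lemma6 :
    (∃ r : ℝ, 0 < r ∧ r < 1 ∧ |r - 0.044951| < 1 / 10 ^ 6 ∧
      ∃ a : ℝ, IsNthPosZero (besselCross 3 r) 1 a ∧ IsNthPosZero (besselCross 0 r) 2 a ∧
        IsDirichletEigenvalue (annulus r) (a ^ 2) ∧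
        3 ≤ dirichletMultiplicity (annulus r) (a ^ 2)) ∧
    (∃ r α lam : ℝ, 0 < r ∧ r < 1 ∧ 0 < α ∧ α ≤ 2 * Real.pi ∧
      IsDirichletEigenvalue (annularSector r α) lam ∧
      2 ≤ dirichletMultiplicity (annularSector r α) lam) := by
  refine ⟨?_, exists_annularSector_double_eigenvalue⟩
  obtain ⟨r, w, hr1, hr2, hw1, hw2, h3, h0⟩ := exists_common_zero
  have hr : 0 < r := by linarith
  have hw : 0 < w := by linarith
  have hra : 0.04 ≤ r := by linarith
  have hrb : r ≤ 0.045 := by linarith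
  refine ⟨r, hr, by linarith, ?_, 2 * √w,
    isNthPosZero_besselCross_three hra hrb hw hw2.le h3,
    isNthPosZero_besselCross_zero hr (by linarith) hw1.le hw2.le h0, ?_⟩
  · rw [abs_lt]; constructor <;> norm_num at hr1 hr2 ⊢ <;> linarith
  have e : (2 * √w) ^ 2 = 4 * w := by rw [mul_pow, Real.sq_sqrt hw.le]; ring
  rw [e]
  have h3' : crossSol 3 (r ^ 2 * w) w = 0 := by
    rw [crossThree_eq hr hw] at h3
    exact (mul_eq_zero.1 h3).resolve_left (by positivity)
  obtain ⟨m0, m1⟩ := inner_bounds hra hrb hw.le hw2.le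
  have m0' : 0 < r ^ 2 * w := by positivity
  set m := r ^ 2 * w with hm
  refine annulus_eigen (v₀ := 1) (crossSol_isBesselSol psi_zero_isBesselSol m)
    (crossSol_isBesselSol psi_three_isBesselSol m) hr hw (crossSol_self 0 m) h0
    (crossSol_self 3 m) h3' (by linarith) (by linarith)
    (crossSol_zero_one_pos m0' m1).ne' (crossSol_three_one_pos m0' m1).ne'
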